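/- Let $\{f(\cdot;\theta):\theta\in[\theta_{\min},\theta_{\max}]\}$ be probability densities with respect to a fixed measure on a measurable space, and let $x_0,x_1,\dots$ be independent observations with common density $f(\cdot;\bar\theta)$. Put $f(x_0,\dots,x_{N-1};\theta)=\prod_{n<N}f(x_n;\theta)$. Expectations $\mathbb E$ and probabilities $P$ are taken under the true value $\bar\theta$. Assume: - (A0) $\bar\theta\in(\theta_{\min},\theta_{\max})$. - (A1) For $f(\cdot;\bar\theta)$-almost every $x$, $f(x;\theta)>0$ for all $\theta\in[\theta_{\min},\theta_{\max}]$, and $\theta\mapsto\ln f(x;\theta)$ is three times continuously differentiable on $[\theta_{\min},\theta_{\max}]$ (one-sided derivatives at the end points). - (A2) There are functions $b_0,b_1,b_2,b_3$ of $x$ alone, with finite variance under $f(\cdot;\bar\theta)$, such that for $f(\cdot;\bar\theta)$-almost every $x$, $\left|\frac{\partial^i}{\partial\theta^i}\ln f(x;\theta)\right|\le b_i(x)$ for all $\theta\in[\theta_{\min},\theta_{\max}]$ and $i=0,1,2,3$. - (A3) The Kullback–Leibler divergence $D(\theta)=\int f(x;\bar\theta)\ln\frac{f(x;\bar\theta)}{f(x;\theta)}\,dx$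 has a unique minimum over $[\theta_{\min},\theta_{\max}]$ at $\theta=\bar\theta$. - (A4) $\mathbb E\left[\frac{\partial^2}{\partial\theta^2}\ln f(x;\bar\theta)\right]\neq 0$. Let $\hat\theta_N$ be a maximum likelihood estimator, that is, a measurable function of $x_0,\dots,x_{N-1}$ that almost surely maximizes $f(x_0,\dots,x_{N-1};\theta)$ over $\theta\in[\theta_{\min},\theta_{\max}]$. Let $\operatorname{MSE}_N=\mathbb E[(\hat\theta_N-\bar\theta)^2]$ be its true MSE, let $$\widehat{\operatorname{MSE}}_N=2\int_{(\theta_{\min}-\bar\theta)/2}^{(\theta_{\max}-\bar\theta)/2}|\epsilon|\,P\!\left(\frac{f(x_0,\dots,x_{N-1};\bar\theta+2\epsilon)}{f(x_0,\dots,x_{N-1};\bar\theta)}\ge1\right)d\epsilon$$ be its finite-support predicted MSE, and let $\mathcal I(\bar\theta)=\mathbb E\left[\left(\frac{\partial}{\partial\theta}\ln f(x;\bar\theta)\right)^2\right]$ be the Fisher information of one observation. Then: 1. The integral defining $\widehat{\operatorname{MSE}}_N$ converges for every $N$, and $\hat\theta_N\to\bar\theta$ almost surely as $N\to\infty$. 2.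 The predicted MSE converges to the true large-sample MSE: $N\operatorname{MSE}_N$ and $N\,\widehat{\operatorname{MSE}}_N$ converge, as $N\to\infty$, to the same finite limit; and if $\mathcal I(\bar\theta)>0$, then $\widehat{\operatorname{MSE}}_N/\operatorname{MSE}_N\to1$. 3. If moreover $\hat\theta_N$ is asymptotically efficient, that is, $\mathcal I(\bar\theta)>0$ and $N\operatorname{MSE}_N\to\mathcal I(\bar\theta)^{-1}$, then the predicted MSE converges to the CRLB, the inverse Fisher information: $N\,\widehat{\operatorname{MSE}}_N\to\mathcal I(\bar\theta)^{-1}$. -/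

import Mathlib

open MeasureTheory ProbabilityTheory Filter Topology Set

noncomputable section

/-- The distribution of one observation: the measure with density `f θ` with respect to `μ`. -/
def obsLaw {S : Type*} [MeasurableSpace S] (μ : Measure S) (f : ℝ → S → ℝ) (θ : ℝ) : Measure S :=
  μ.withDensity (fun x => ENNReal.ofReal (f θ x))

/-- `f θ`, for `θ ∈ Θ`, are probability densities with respect to `μ`. -/
structure IsDensityFamily {S : Type*} [MeasurableSpace S] (μ : Measure S) (f : ℝ → S → ℝ)
    (Θ : Set ℝ) : Prop where
  measurable : ∀ θ ∈ Θ, Measurable (f θ)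
  nonneg : ∀ θ ∈ Θ, ∀ x, 0 ≤ f θ x
  lintegral_eq_one : ∀ θ ∈ Θ, ∫⁻ x, ENNReal.ofReal (f θ x) ∂μ = 1

/-- The `i`-th derivative in `θ` of `ln f(x; θ)`, relative to the parameter set `Θ` (one-sided at
the end points when `Θ` is a closed interval; for `i = 0` it is `ln f(x; θ)` itself). -/
def logDensityDeriv {S : Type*} (f : ℝ → S → ℝ) (Θ : Set ℝ) (i : ℕ) (θ : ℝ) (x : S) : ℝ :=
  iteratedDerivWithin i (fun t => Real.log (f t x)) Θ θ

/-- The Kullback-Leibler divergence `D(f(x; θ₀) || f(x; θ))`. -/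
def klDensity {S : Type*} [MeasurableSpace S] (μ : Measure S) (f : ℝ → S → ℝ) (θ₀ θ : ℝ) : ℝ :=
  ∫ x, f θ₀ x * Real.log (f θ₀ x / f θ x) ∂μ

/-- The Fisher information of one observation at `θ₀`: the expected squared score. -/
def fisherInformation {S : Type*} [MeasurableSpace S] (μ : Measure S) (f : ℝ → S → ℝ)
    (Θ : Set ℝ) (θ₀ : ℝ) : ℝ :=
  ∫ x, (logDensityDeriv f Θ 1 θ₀ x) ^ 2 ∂(obsLaw μ f θ₀)

/-- The likelihood of `N` independent observations. -/
def likelihood {S : Type*} (f : ℝ → S → ℝ) {N : ℕ} (x : Fin N → S) (θ : ℝ) : ℝ :=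
  ∏ n, f θ (x n)

/-- The vector of the first `N` observations. -/
def sample {S Ω : Type*} (X : ℕ → Ω → S) (N : ℕ) (ω : Ω) : Fin N → S :=
  fun n => X n ω

/-- `est N` is, for every sample size `N`, a measurable function of the first `N` observations and
almost surely a maximizer over `Θ` of their likelihood. -/
def IsMLE {S Ω : Type*} [MeasurableSpace S] [MeasurableSpace Ω] (P : Measure Ω) (X : ℕ → Ω → S)
    (f : ℝ → S → ℝ) (Θ : Set ℝ) (est : (N : ℕ) → (Fin N → S) → ℝ) : Prop :=
  ∀ N, Measurable (est N) ∧
    ∀ᵐ ω ∂P, est N (sample X N ω) ∈ Θ ∧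
      IsMaxOn (likelihood f (sample X N ω)) Θ (est N (sample X N ω))

/-- The true mean square error of the estimator for sample size `N`. -/
def trueMSE {S Ω : Type*} [MeasurableSpace Ω] (P : Measure Ω) (X : ℕ → Ω → S)
    (est : (N : ℕ) → (Fin N → S) → ℝ) (θ₀ : ℝ) (N : ℕ) : ℝ :=
  ∫ ω, (est N (sample X N ω) - θ₀) ^ 2 ∂P

/-- The integrand `|ε| P(f(x; θ₀ + 2ε) / f(x; θ₀) ≥ 1)` of the predicted mean square error, for
sample size `N`. -/
def predictedMSEIntegrand {S Ω : Type*} [MeasurableSpace Ω] (P : Measure Ω) (X : ℕ → Ω → S)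
    (f : ℝ → S → ℝ) (θ₀ : ℝ) (N : ℕ) (ε : ℝ) : ℝ :=
  |ε| * P.real {ω | likelihood f (sample X N ω) (θ₀ + 2 * ε) /
    likelihood f (sample X N ω) θ₀ ≥ 1}

/-- The finite-support predicted mean square error of the maximum likelihood estimator for
sample size `N` and parameter set `[θmin, θmax]`. -/
def predictedMSE {S Ω : Type*} [MeasurableSpace Ω] (P : Measure Ω) (X : ℕ → Ω → S)
    (f : ℝ → S → ℝ) (θmin θmax θ₀ : ℝ) (N : ℕ) : ℝ :=
  2 * ∫ ε in ((θmin - θ₀) / 2)..((θmax - θ₀) / 2), predictedMSEIntegrand P X f θ₀ N ε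

/-- Asymptotic efficiency at `θ₀`: the Fisher information of one observation is positive, and the
mean square error is asymptotically the Cramer-Rao lower bound `1 / (N * I(θ₀))` of `N`
observations. -/
def AsymptoticallyEfficient {S Ω : Type*} [MeasurableSpace S] [MeasurableSpace Ω]
    (μ : Measure S) (P : Measure Ω) (X : ℕ → Ω → S) (f : ℝ → S → ℝ) (Θ : Set ℝ)
    (est : (N : ℕ) → (Fin N → S) → ℝ) (θ₀ : ℝ) : Prop :=
  0 < fisherInformation μ f Θ θ₀ ∧
    Tendsto (fun N : ℕ => (N : ℝ) * trueMSE P X est θ₀ N) atTop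
      (𝓝 (fisherInformation μ f Θ θ₀)⁻¹)

end

/-! Let `L t` be the mean log-likelihood ratio of `θ₀ + t` against `θ₀`, `s` the mean score at `θ₀`
and `-J < 0` the expected second derivative of the log-density. Outside events of probability
`o(1 / N)`, `L` lies between the parabolas `s t - (J ± η) t² / 2` near `0` and is negative
elsewhere. There the maximizer of `L` is close to `s / J`, and `{ε | 0 ≤ L (2 ε)}` is almost the
interval between `0` and `s / J`, over which `2 ∫ |ε|` equals `(s / J)²`. So the squared error of
the maximum likelihood estimator and, by Fubini, the integrand of the predicted mean square error
are both approximated by `(s / J)²`. Since `N s²` converges in distribution by the central limit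
theorem while its mean does not depend on `N`, it is uniformly integrable, which makes the
exceptional events negligible at the scale `1 / N`. -/

section UniformIntegrability

variable {Ω : Type*} [MeasurableSpace Ω] {P : Measure Ω} {W : Ω → ℝ}

theorem tendsto_integral_min_natCast (hW : Integrable W P) (hW0 : 0 ≤ W) :
    Tendsto (fun K : ℕ => ∫ ω, min (W ω) K ∂P) atTop (𝓝 (∫ ω, W ω ∂P)) := by
  refine tendsto_integral_of_dominated_convergence W
    (fun K => (hW.aestronglyMeasurable.aemeasurable.min aemeasurable_const).aestronglyMeasurable)
    hW (fun K => ae_of_all _ fun ω => ?_) (ae_of_all _ fun ω => ?_)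
  · rw [Real.norm_eq_abs, abs_of_nonneg (le_min (hW0 ω) K.cast_nonneg)]
    exact min_le_left _ _
  · refine tendsto_const_nhds.congr' ?_
    filter_upwards [eventually_ge_atTop ⌈W ω⌉₊] with K hK
    exact (min_eq_left (Nat.ceil_le.1 hK)).symm

theorem setIntegral_le_mul_add_integral_sub_min [IsFiniteMeasure P] (hW : Integrable W P)
    (K : ℝ) (A : Set Ω) :
    ∫ ω in A, W ω ∂P ≤ K * P.real A + (∫ ω, W ω ∂P - ∫ ω, min (W ω) K ∂P) := by
  have hmin : Integrable (fun ω => min (W ω) K) P := hW.inf (integrable_const K)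
  have hsub : Integrable (fun ω => W ω - min (W ω) K) P := hW.sub hmin
  calc ∫ ω in A, W ω ∂P ≤ ∫ ω in A, (K + (W ω - min (W ω) K)) ∂P :=
        integral_mono hW.integrableOn ((integrable_const K).add hsub).integrableOn fun ω => by
          linarith [min_le_right (W ω) K]
    _ = K * P.real A + ∫ ω in A, (W ω - min (W ω) K) ∂P := by
        rw [integral_add (integrable_const K) hsub.integrableOn, setIntegral_const, smul_eq_mul,
          mul_comm]
    _ ≤ K * P.real A + ∫ ω, (W ω - min (W ω) K) ∂P := by
        gcongr
        · exact ae_of_all _ fun ω => sub_nonneg.2 (min_le_left _ _)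
        · exact Measure.restrict_le_self
    _ = _ := by rw [integral_sub hW hmin]

variable {ι Ω' E : Type*} [MeasurableSpace Ω'] [TopologicalSpace E] [MeasurableSpace E]
  [OpensMeasurableSpace E] {P' : Measure Ω'} [IsProbabilityMeasure P] [IsProbabilityMeasure P']
  {T : ι → Ω → E} {Z : Ω' → E} {l : Filter ι} {g : E → ℝ}

theorem tendsto_integral_min_of_tendstoInDistribution
    (h : TendstoInDistribution T l Z (fun _ => P) P') (hg : Continuous g) (hg0 : 0 ≤ g) {K : ℝ}
    (hK : 0 ≤ K) :
    Tendsto (fun i => ∫ ω, min (g (T i ω)) K ∂P) l (𝓝 (∫ ω, min (g (Z ω)) K ∂P')) := by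
  let φ : BoundedContinuousFunction E ℝ :=
    .ofNormedAddCommGroup (fun x => min (g x) K) (hg.min continuous_const) K fun x => by
      rw [Real.norm_eq_abs, abs_of_nonneg (le_min (hg0 x) hK)]
      exact min_le_right _ _
  have hφ := ProbabilityMeasure.tendsto_iff_forall_integral_tendsto.1 h.tendsto φ
  have hsm {m : Measure E} : AEStronglyMeasurable φ m :=
    φ.continuous.measurable.aestronglyMeasurable
  simp only [ProbabilityMeasure.coe_mk, integral_map h.aemeasurable_limit hsm,
    integral_map (h.forall_aemeasurable _) hsm] at hφ
  exact hφ

theorem tendsto_setIntegral_of_tendstoInDistribution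
    (h : TendstoInDistribution T l Z (fun _ => P) P') (hg : Continuous g) (hg0 : 0 ≤ g)
    (hT : ∀ i, Integrable (fun ω => g (T i ω)) P) (hZ : Integrable (fun ω => g (Z ω)) P')
    (hE : Tendsto (fun i => ∫ ω, g (T i ω) ∂P) l (𝓝 (∫ ω, g (Z ω) ∂P')))
    {A : ι → Set Ω} (hA : Tendsto (fun i => P.real (A i)) l (𝓝 0)) :
    Tendsto (fun i => ∫ ω in A i, g (T i ω) ∂P) l (𝓝 0) := by
  refine (tendsto_order.2 ⟨fun c hc => Eventually.of_forall fun i =>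
    hc.trans_le (integral_nonneg fun ω => hg0 _), fun c hc => ?_⟩)
  have htail : Tendsto (fun K : ℕ => ∫ ω, g (Z ω) ∂P' - ∫ ω, min (g (Z ω)) K ∂P') atTop (𝓝 0) := by
    simpa using (tendsto_integral_min_natCast hZ fun ω => hg0 _).const_sub (∫ ω, g (Z ω) ∂P')
  obtain ⟨K, hK⟩ := (htail.eventually_lt_const hc).exists
  have hbound := (hA.const_mul (K : ℝ)).add
    (hE.sub (tendsto_integral_min_of_tendstoInDistribution h hg hg0 K.cast_nonneg))
  rw [mul_zero, zero_add] at hbound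
  filter_upwards [hbound.eventually_lt_const hK] with i hi
  exact (setIntegral_le_mul_add_integral_sub_min (hT i) K (A i)).trans_lt hi

end UniformIntegrability

theorem abs_integral_sub_mul_integral_le {Ω : Type*} [MeasurableSpace Ω] {P : Measure Ω}
    [IsFiniteMeasure P] {W Q : Ω → ℝ} {c ε D : ℝ} {B : Set Ω} (hW : Integrable W P)
    (hQ : Integrable Q P) (hQ0 : 0 ≤ Q) (hε : 0 ≤ ε)
    (hWD : ∀ᵐ ω ∂P, |W ω| ≤ D) (hWQ : ∀ᵐ ω ∂P, ω ∉ B → |W ω - c * Q ω| ≤ ε * Q ω) :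
    |∫ ω, W ω ∂P - c * ∫ ω, Q ω ∂P| ≤
      ε * ∫ ω, Q ω ∂P + (D * P.real B + |c| * ∫ ω in toMeasurable P B, Q ω ∂P) := by
  have hmeas : MeasurableSet (toMeasurable P B) := measurableSet_toMeasurable P B
  have hbad : IntegrableOn (fun ω => D + |c| * Q ω) (toMeasurable P B) P :=
    ((integrable_const D).add (hQ.const_mul |c|)).integrableOn
  have hpointwise : ∀ᵐ ω ∂P, |W ω - c * Q ω| ≤
      ε * Q ω + (toMeasurable P B).indicator (fun ω => D + |c| * Q ω) ω := by
    filter_upwards [hWD, hWQ] with ω hD hgood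
    by_cases hω : ω ∈ toMeasurable P B
    · have hQω : |c * Q ω| = |c| * Q ω := by rw [abs_mul, abs_of_nonneg (hQ0 ω)]
      rw [indicator_of_mem hω]
      linarith [abs_sub (W ω) (c * Q ω), mul_nonneg hε (hQ0 ω)]
    · rw [indicator_of_notMem hω, add_zero]
      exact hgood fun hB => hω (subset_toMeasurable P B hB)
  calc |∫ ω, W ω ∂P - c * ∫ ω, Q ω ∂P| = |∫ ω, (W ω - c * Q ω) ∂P| := by
        rw [integral_sub hW (hQ.const_mul c), integral_const_mul]
    _ ≤ ∫ ω, |W ω - c * Q ω| ∂P := abs_integral_le_integral_abs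
    _ ≤ ∫ ω, (ε * Q ω + (toMeasurable P B).indicator (fun ω => D + |c| * Q ω) ω) ∂P :=
        integral_mono_ae (hW.sub (hQ.const_mul c)).abs
          ((hQ.const_mul ε).add (hbad.integrable_indicator hmeas)) hpointwise
    _ = _ := by
        rw [integral_add (hQ.const_mul ε) (hbad.integrable_indicator hmeas), integral_const_mul,
          integral_indicator hmeas, integral_add (integrable_const D) (hQ.const_mul |c|).restrict,
          setIntegral_const, integral_const_mul, measureReal_def, measure_toMeasurable,
          ← measureReal_def, smul_eq_mul, mul_comm D]

/-- Events indexed by the sample size `N` that have probability `o(1 / N)` and of which almost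
surely only finitely many occur: negligible both for mean square errors at the scale `1 / N` and for
strong consistency. -/
structure Rare {Ω : Type*} [MeasurableSpace Ω] (P : Measure Ω) (B : ℕ → Set Ω) : Prop where
  tendsto_mul_measureReal : Tendsto (fun N : ℕ => (N : ℝ) * P.real (B N)) atTop (𝓝 0)
  eventually_notMem : ∀ᵐ ω ∂P, ∀ᶠ N in atTop, ω ∉ B N

namespace Rare

variable {Ω : Type*} [MeasurableSpace Ω] {P : Measure Ω} {B C : ℕ → Set Ω}

theorem mono [IsFiniteMeasure P] (hC : Rare P C) (h : ∀ N, B N ⊆ C N) : Rare P B where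
  tendsto_mul_measureReal :=
    squeeze_zero (fun N => by positivity)
      (fun N => mul_le_mul_of_nonneg_left (measureReal_mono (h N)) N.cast_nonneg)
      hC.tendsto_mul_measureReal
  eventually_notMem := by
    filter_upwards [hC.eventually_notMem] with ω hω using hω.mono fun N hN hB => hN (h N hB)

theorem union (hB : Rare P B) (hC : Rare P C) : Rare P (fun N => B N ∪ C N) where
  tendsto_mul_measureReal := by
    refine squeeze_zero (fun N => by positivity) (fun N => ?_)
      (by simpa using hB.tendsto_mul_measureReal.add hC.tendsto_mul_measureReal)
    rw [← mul_add]
    exact mul_le_mul_of_nonneg_left (measureReal_union_le _ _) N.cast_nonneg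
  eventually_notMem := by
    filter_upwards [hB.eventually_notMem, hC.eventually_notMem] with ω hω hω'
    filter_upwards [hω, hω'] with N hN hN'
    exact not_or.2 ⟨hN, hN'⟩

theorem of_ae_notMem {s : Set Ω} (hs : ∀ᵐ ω ∂P, ω ∉ s) : Rare P (fun _ => s) where
  tendsto_mul_measureReal := by
    have hzero : P.real s = 0 := by
      rw [measureReal_def, measure_eq_zero_iff_ae_notMem.2 hs, ENNReal.toReal_zero]
    simp only [hzero, mul_zero, tendsto_const_nhds]
  eventually_notMem := hs.mono fun ω hω => Eventually.of_forall fun _ => hω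

theorem tendsto_measureReal (hB : Rare P B) : Tendsto (fun N => P.real (B N)) atTop (𝓝 0) := by
  refine squeeze_zero' (Eventually.of_forall fun N => measureReal_nonneg) ?_
    hB.tendsto_mul_measureReal
  filter_upwards [eventually_ge_atTop 1] with N hN
  exact le_mul_of_one_le_left measureReal_nonneg (Nat.one_le_cast.2 hN)

end Rare

/-- The mean of `g` over the first `N` observations; it is `0` for `N = 0`. -/
noncomputable def empMean {S Ω : Type*} (X : ℕ → Ω → S) (g : S → ℝ) (N : ℕ) (ω : Ω) : ℝ :=
  (∑ i ∈ Finset.range N, g (X i ω)) / N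

section EmpMean

variable {S Ω : Type*} {X : ℕ → Ω → S} {g h : S → ℝ} {N : ℕ} {ω : Ω}

theorem empMean_add : empMean X (g + h) N ω = empMean X g N ω + empMean X h N ω := by
  simp only [empMean, Pi.add_apply, Finset.sum_add_distrib, add_div]

theorem empMean_sub : empMean X (g - h) N ω = empMean X g N ω - empMean X h N ω := by
  simp only [empMean, Pi.sub_apply, Finset.sum_sub_distrib, sub_div]

theorem empMean_smul (c : ℝ) : empMean X (c • g) N ω = c * empMean X g N ω := by
  simp only [empMean, Pi.smul_apply, smul_eq_mul, ← Finset.mul_sum, mul_div_assoc]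

theorem abs_empMean_le (H : ∀ n, |g (X n ω)| ≤ h (X n ω)) :
    |empMean X g N ω| ≤ empMean X h N ω := by
  rw [empMean, empMean, abs_div, Nat.abs_cast]
  gcongr
  exact (Finset.abs_sum_le_sum_abs _ _).trans (Finset.sum_le_sum fun i _ => H i)

theorem empMean_nonneg_iff : 0 ≤ empMean X g N ω ↔ 0 ≤ ∑ i ∈ Finset.range N, g (X i ω) := by
  rcases N.eq_zero_or_pos with rfl | hN
  · simp [empMean]
  · rw [empMean, le_div_iff₀ (Nat.cast_pos.2 hN), zero_mul]

end EmpMean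

/-- Independent observations with common law `ν`. -/
structure IsIIDSample {S Ω : Type*} [MeasurableSpace S] [MeasurableSpace Ω] (P : Measure Ω)
    (X : ℕ → Ω → S) (ν : Measure S) : Prop where
  measurable : ∀ n, Measurable (X n)
  indep : iIndepFun X P
  law : ∀ n, P.map (X n) = ν

namespace IsIIDSample

variable {S Ω : Type*} [MeasurableSpace S] [MeasurableSpace Ω] {P : Measure Ω}
  {X : ℕ → Ω → S} {ν : Measure S} {g : S → ℝ}

theorem measurePreserving (hX : IsIIDSample P X ν) (n : ℕ) : MeasurePreserving (X n) P ν :=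
  ⟨hX.measurable n, hX.law n⟩

theorem ae_forall (hX : IsIIDSample P X ν) {p : S → Prop} (hp : ∀ᵐ x ∂ν, p x) :
    ∀ᵐ ω ∂P, ∀ n, p (X n ω) :=
  ae_all_iff.2 fun n => (hX.measurePreserving n).quasiMeasurePreserving.ae hp

theorem identDistrib (hX : IsIIDSample P X ν) (hg : AEMeasurable g ν) (n : ℕ) :
    IdentDistrib (fun ω => g (X n ω)) g P ν where
  aemeasurable_fst := hg.comp_quasiMeasurePreserving (hX.measurePreserving n).quasiMeasurePreserving
  aemeasurable_snd := hg
  map_eq := by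
    rw [← hX.law n] at hg ⊢
    exact (AEMeasurable.map_map_of_aemeasurable hg (hX.measurable n).aemeasurable).symm

theorem iIndepFun_comp (hX : IsIIDSample P X ν) (hg : AEMeasurable g ν) :
    iIndepFun (fun n ω => g (X n ω)) P :=
  hX.indep.comp₀ (fun _ => g) (fun n => (hX.measurable n).aemeasurable) fun n =>
    (hX.law n).symm ▸ hg

theorem memLp_comp (hX : IsIIDSample P X ν) (hg : MemLp g 2 ν) (n : ℕ) :
    MemLp (fun ω => g (X n ω)) 2 P :=
  hg.comp_measurePreserving (hX.measurePreserving n)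

theorem memLp_empMean (hX : IsIIDSample P X ν) (hg : MemLp g 2 ν) (N : ℕ) :
    MemLp (empMean X g N) 2 P := by
  have hsum := memLp_finsetSum (Finset.range N) fun i _ => hX.memLp_comp hg i
  exact (funext fun ω => div_eq_mul_inv _ _ : empMean X g N = _) ▸ hsum.mul_const (N : ℝ)⁻¹

theorem ae_tendsto_empMean (hX : IsIIDSample P X ν) (hg : Integrable g ν) :
    ∀ᵐ ω ∂P, Tendsto (fun N => empMean X g N ω) atTop (𝓝 (∫ x, g x ∂ν)) := by
  have hm := hg.aestronglyMeasurable.aemeasurable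
  rw [← (hX.identDistrib hm 0).integral_eq]
  exact strong_law_ae_real _ ((hX.measurePreserving 0).integrable_comp_of_integrable hg)
    (fun i j hij => (hX.iIndepFun_comp hm).indepFun hij)
    fun i => (hX.identDistrib hm i).trans (hX.identDistrib hm 0).symm

theorem integral_empMean (hX : IsIIDSample P X ν) (hg : Integrable g ν) {N : ℕ} (hN : N ≠ 0) :
    ∫ ω, empMean X g N ω ∂P = ∫ x, g x ∂ν := by
  have hmean (i : ℕ) : ∫ ω, g (X i ω) ∂P = ∫ x, g x ∂ν :=
    (hX.identDistrib hg.aestronglyMeasurable.aemeasurable i).integral_eq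
  simp only [empMean]
  rw [integral_div, integral_finsetSum (f := fun i ω => g (X i ω)) _ fun i _ =>
    (hX.measurePreserving i).integrable_comp_of_integrable hg]
  simp only [hmean, Finset.sum_const, Finset.card_range, nsmul_eq_mul]
  field_simp

variable [IsProbabilityMeasure P]

theorem isProbabilityMeasure (hX : IsIIDSample P X ν) : IsProbabilityMeasure ν :=
  hX.law 0 ▸ Measure.isProbabilityMeasure_map (hX.measurable 0).aemeasurable

theorem integrable_sq_empMean_sub (hX : IsIIDSample P X ν) (hg : MemLp g 2 ν) (m : ℝ) (N : ℕ) :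
    Integrable (fun ω => (empMean X g N ω - m) ^ 2) P :=
  ((hX.memLp_empMean hg N).sub (memLp_const m)).integrable_sq

theorem mul_integral_sq_empMean_sub (hX : IsIIDSample P X ν) (hg : MemLp g 2 ν) {N : ℕ}
    (hN : N ≠ 0) :
    N * ∫ ω, (empMean X g N ω - ∫ x, g x ∂ν) ^ 2 ∂P = Var[g; ν] := by
  have hm := hg.aestronglyMeasurable.aemeasurable
  have := hX.isProbabilityMeasure
  have hsum : Var[∑ i ∈ Finset.range N, fun ω => g (X i ω); P] = N * Var[g; ν] := by
    rw [IndepFun.variance_sum (fun i _ => hX.memLp_comp hg i) fun i _ j _ hij =>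
      (hX.iIndepFun_comp hm).indepFun hij]
    simp only [(hX.identDistrib hm _).variance_eq, Finset.sum_const, Finset.card_range,
      nsmul_eq_mul]
  have hscale : empMean X g N = fun ω => (N : ℝ)⁻¹ * (∑ i ∈ Finset.range N, fun ω => g (X i ω)) ω :=
    funext fun ω => by rw [empMean, Finset.sum_apply, div_eq_inv_mul]
  rw [← hX.integral_empMean (hg.integrable one_le_two) hN,
    ← variance_eq_integral (hX.memLp_empMean hg N).aestronglyMeasurable.aemeasurable, hscale,
    variance_const_mul, hsum]
  field_simp

theorem tendstoInDistribution_empMean (hX : IsIIDSample P X ν) (hg : MemLp g 2 ν) :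
    TendstoInDistribution (fun (N : ℕ) ω => √N * (empMean X g N ω - ∫ x, g x ∂ν)) atTop id
      (fun _ => P) (gaussianReal 0 Var[g; ν].toNNReal) := by
  have hm := hg.aestronglyMeasurable.aemeasurable
  have hlaw := hX.identDistrib hm 0
  have hfun : (fun (N : ℕ) ω => √N * (empMean X g N ω - ∫ x, g x ∂ν)) = fun (N : ℕ) ω =>
      (√N)⁻¹ * (∑ i ∈ Finset.range N, g (X i ω) - N * ∫ ω, g (X 0 ω) ∂P) := by
    ext N ω
    rcases N.eq_zero_or_pos with rfl | hN
    · simp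
    · have hN' : (0 : ℝ) < N := Nat.cast_pos.2 hN
      rw [hlaw.integral_eq, empMean, div_sub' hN'.ne', mul_div_left_comm, Real.sqrt_div_self,
        mul_comm]
  rw [hfun]
  exact tendstoInDistribution_inv_sqrt_mul_sum_sub (hlaw.variance_eq ▸ .id) (hX.memLp_comp hg 0)
    (hX.iIndepFun_comp hm) fun i => (hX.identDistrib hm i).trans hlaw.symm

theorem tendsto_mul_setIntegral_sq_empMean_sub (hX : IsIIDSample P X ν) (hg : MemLp g 2 ν)
    {A : ℕ → Set Ω} (hA : Tendsto (fun N => P.real (A N)) atTop (𝓝 0)) :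
    Tendsto (fun N : ℕ => N * ∫ ω in A N, (empMean X g N ω - ∫ x, g x ∂ν) ^ 2 ∂P) atTop
      (𝓝 0) := by
  have hsq (N : ℕ) (ω : Ω) : (√N * (empMean X g N ω - ∫ x, g x ∂ν)) ^ 2 =
      N * (empMean X g N ω - ∫ x, g x ∂ν) ^ 2 := by
    rw [mul_pow, Real.sq_sqrt N.cast_nonneg]
  have hgauss : MemLp id 2 (gaussianReal 0 Var[g; ν].toNNReal) := memLp_id_gaussianReal 2
  have hgauss_sq : ∫ x, id x ^ 2 ∂(gaussianReal 0 Var[g; ν].toNNReal) = Var[g; ν] := by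
    rw [← variance_of_integral_eq_zero aemeasurable_id (by simp), variance_id_gaussianReal,
      Real.coe_toNNReal _ (variance_nonneg _ _)]
  have hUI := tendsto_setIntegral_of_tendstoInDistribution (g := fun x : ℝ => x ^ 2)
    (hX.tendstoInDistribution_empMean hg) (by fun_prop) (fun x => sq_nonneg x)
    (fun N => by simpa only [hsq] using (hX.integrable_sq_empMean_sub hg _ N).const_mul (N : ℝ))
    hgauss.integrable_sq (by
      simp only [hsq, integral_const_mul]
      rw [hgauss_sq]
      refine tendsto_const_nhds.congr' ?_
      filter_upwards [eventually_ne_atTop 0] with N hN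
      exact (hX.mul_integral_sq_empMean_sub hg hN).symm) hA
  simpa only [hsq, integral_const_mul] using hUI

theorem rare_le_abs_empMean_sub (hX : IsIIDSample P X ν) (hg : MemLp g 2 ν) {ε : ℝ}
    (hε : 0 < ε) : Rare P (fun N => {ω | ε ≤ |empMean X g N ω - ∫ x, g x ∂ν|}) where
  tendsto_mul_measureReal := by
    have := hX.isProbabilityMeasure
    have hprob := tendstoInMeasure_iff_measureReal_norm.1 (tendstoInMeasure_of_tendsto_ae
      (fun N => (hX.memLp_empMean hg N).aestronglyMeasurable)
      (hX.ae_tendsto_empMean (hg.integrable one_le_two))) ε hε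
    have hmarkov := (hX.tendsto_mul_setIntegral_sq_empMean_sub hg hprob).div_const (ε ^ 2)
    rw [zero_div] at hmarkov
    refine squeeze_zero (fun N => by positivity) (fun N => ?_) hmarkov
    rw [mul_div_assoc]
    gcongr
    rw [le_div_iff₀ (by positivity), ← smul_eq_mul, ← setIntegral_const]
    have hmeas : AEMeasurable (fun ω => |empMean X g N ω - ∫ x, g x ∂ν|) P :=
      ((hX.memLp_empMean hg N).aestronglyMeasurable.aemeasurable.sub_const _).abs
    refine setIntegral_mono_on₀ (integrable_const _).integrableOn
      (hX.integrable_sq_empMean_sub hg _ N).integrableOn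
      (nullMeasurableSet_le aemeasurable_const hmeas) fun ω hω => ?_
    rw [← sq_abs (_ - _)]
    exact pow_le_pow_left₀ hε.le hω 2
  eventually_notMem := by
    have := hX.isProbabilityMeasure
    filter_upwards [hX.ae_tendsto_empMean (hg.integrable one_le_two)] with ω hω
    filter_upwards [(tendsto_iff_norm_sub_tendsto_zero.1 hω).eventually_lt_const hε] with N hN
    exact not_le.2 hN

theorem tendsto_mul_integral_of_rare (hX : IsIIDSample P X ν) (hg : MemLp g 2 ν) {c D : ℝ}
    {W : ℕ → Ω → ℝ} (hW : ∀ N, AEStronglyMeasurable (W N) P) (hWD : ∀ N, ∀ᵐ ω ∂P, |W N ω| ≤ D)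
    (happrox : ∀ ε > 0, ∃ B, Rare P B ∧ ∀ N, ∀ᵐ ω ∂P, ω ∉ B N →
      |W N ω - c * (empMean X g N ω - ∫ x, g x ∂ν) ^ 2| ≤
        ε * (empMean X g N ω - ∫ x, g x ∂ν) ^ 2) :
    Tendsto (fun N : ℕ => N * ∫ ω, W N ω ∂P) atTop (𝓝 (c * Var[g; ν])) := by
  rw [Metric.tendsto_nhds]
  intro κ hκ
  set V := Var[g; ν] with hV_def
  have hV : 0 ≤ V := variance_nonneg g ν
  obtain ⟨B, hB, hWB⟩ := happrox (κ / (V + 1)) (by positivity)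
  have hsmall : κ / (V + 1) * V < κ := by
    rw [div_mul_eq_mul_div, div_lt_iff₀ (by positivity)]
    nlinarith
  have hrest := ((hB.tendsto_mul_measureReal.const_mul D).add
    ((hX.tendsto_mul_setIntegral_sq_empMean_sub hg (A := fun N => toMeasurable P (B N)) (by
      simpa only [measureReal_def, measure_toMeasurable] using hB.tendsto_measureReal)).const_mul
        |c|)).const_add (κ / (V + 1) * V)
  rw [mul_zero, mul_zero, add_zero, add_zero] at hrest
  filter_upwards [hrest.eventually_lt_const hsmall, eventually_ne_atTop 0] with N hlt hN
  have hint := abs_integral_sub_mul_integral_le (.of_bound (hW N) D (hWD N))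
    (hX.integrable_sq_empMean_sub hg _ N) (fun ω => sq_nonneg _) (by positivity) (hWD N) (hWB N)
  rw [Real.dist_eq]
  refine lt_of_le_of_lt ?_ hlt
  calc |N * ∫ ω, W N ω ∂P - c * V|
      = N * |∫ ω, W N ω ∂P - c * ∫ ω, (empMean X g N ω - ∫ x, g x ∂ν) ^ 2 ∂P| := by
        rw [hV_def, ← hX.mul_integral_sq_empMean_sub hg hN, mul_left_comm c, ← mul_sub, abs_mul,
          Nat.abs_cast]
    _ ≤ _ := mul_le_mul_of_nonneg_left hint N.cast_nonneg
    _ = _ := by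
        rw [hV_def, ← hX.mul_integral_sq_empMean_sub hg hN]
        ring

end IsIIDSample

/-- On the parameter set `T`, the function `L` agrees within distance `δ` of `0` with the parabola
`s * t - J * t ^ 2 / 2` up to the fraction `η` of the quadratic term, and it is negative further
away. It models the mean log-likelihood ratio as a function of the deviation from the true
parameter. -/
structure IsNearParabola (L : ℝ → ℝ) (T : Set ℝ) (s J η δ : ℝ) : Prop where
  pos : 0 < δ
  Icc_subset : Icc (-δ) δ ⊆ T
  abs_sub_le : ∀ t, |t| ≤ δ → |L t - (s * t - J * t ^ 2 / 2)| ≤ η * t ^ 2 / 2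
  neg : ∀ t ∈ T, δ ≤ |t| → L t < 0

theorem mem_uIcc_zero_div_iff {k s x : ℝ} (hk : 0 < k) :
    x ∈ uIcc 0 (s / k) ↔ k * x ^ 2 ≤ s * x := by
  have hs : s = k * (s / k) := by field_simp
  set r := s / k
  rw [hs, mul_assoc, mul_le_mul_iff_right₀ hk, mem_uIcc]
  constructor
  · rintro (⟨h1, h2⟩ | ⟨h1, h2⟩) <;> nlinarith
  · intro h
    rcases lt_trichotomy x 0 with hx | hx | hx
    · exact .inr ⟨by nlinarith, hx.le⟩
    · exact (le_total 0 r).imp (fun h0 => ⟨hx.ge, hx.trans_le h0⟩) fun h0 => ⟨h0.trans hx.ge, hx.le⟩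
    · exact .inl ⟨hx.le, by nlinarith⟩

theorem setIntegral_uIcc_zero_abs (r : ℝ) : ∫ x in uIcc 0 r, |x| = r ^ 2 / 2 := by
  rcases le_total 0 r with h | h
  · rw [uIcc_of_le h, setIntegral_congr_fun (g := fun x => x) measurableSet_Icc
      (fun x hx => abs_of_nonneg hx.1), integral_Icc_eq_integral_Ioc,
      ← intervalIntegral.integral_of_le h, integral_id]
    ring
  · rw [uIcc_of_ge h, setIntegral_congr_fun (g := fun x => -x) measurableSet_Icc
      (fun x hx => abs_of_nonpos hx.2), integral_Icc_eq_integral_Ioc,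
      ← intervalIntegral.integral_of_le h, intervalIntegral.integral_neg, integral_id]
    ring

theorem abs_sq_sub_sq_le {r t ρ : ℝ} (hρ : ρ ≤ 1) (h : |t - r| ≤ ρ * |r|) :
    |t ^ 2 - r ^ 2| ≤ 3 * ρ * r ^ 2 := by
  have hsum : |t + r| ≤ 3 * |r| := calc
    |t + r| = |(t - r) + 2 * r| := by ring_nf
    _ ≤ |t - r| + 2 * |r| := (abs_add_le _ _).trans_eq (by rw [abs_mul, abs_two])
    _ ≤ 3 * |r| := by nlinarith [abs_nonneg r]
  calc |t ^ 2 - r ^ 2| = |t + r| * |t - r| := by rw [sq_sub_sq, abs_mul]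
    _ ≤ 3 * |r| * (ρ * |r|) := by gcongr
    _ = 3 * ρ * r ^ 2 := by rw [← sq_abs r]; ring

theorem abs_sq_div_add_sub_sq_div_le {s J e ρ : ℝ} (hJ : 0 < J) (hρ : ρ ≤ 1)
    (he : 8 * |e| ≤ ρ * J) : |(s / (J + e)) ^ 2 - (s / J) ^ 2| ≤ 3 * ρ * (s / J) ^ 2 := by
  have hρ0 : 0 ≤ ρ := nonneg_of_mul_nonneg_left (by linarith [abs_nonneg e]) hJ
  have hJe : 0 < J + e := by nlinarith [neg_abs_le e]
  have hdiff : s / (J + e) - s / J = -(e / (J + e)) * (s / J) := by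
    field_simp
    ring
  refine abs_sq_sub_sq_le hρ ?_
  rw [hdiff, abs_mul, abs_neg, abs_div, abs_of_pos hJe]
  refine mul_le_mul_of_nonneg_right ?_ (abs_nonneg _)
  rw [div_le_iff₀ hJe]
  nlinarith [mul_le_mul_of_nonneg_left (neg_abs_le e) hρ0,
    mul_le_mul_of_nonneg_right hρ (abs_nonneg e)]

namespace IsNearParabola

variable {L : ℝ → ℝ} {T : Set ℝ} {s J η δ t ρ : ℝ}

theorem sub_le (h : IsNearParabola L T s J η δ) (ht : |t| ≤ δ) :
    s * t - (J + η) * t ^ 2 / 2 ≤ L t := by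
  linarith [(abs_le.1 (h.abs_sub_le t ht)).1]

theorem le_sub (h : IsNearParabola L T s J η δ) (ht : |t| ≤ δ) :
    L t ≤ s * t - (J - η) * t ^ 2 / 2 := by
  linarith [(abs_le.1 (h.abs_sub_le t ht)).2]

theorem error_nonneg (h : IsNearParabola L T s J η δ) : 0 ≤ η := by
  have hδ := (abs_nonneg _).trans (h.abs_sub_le δ (abs_of_pos h.pos).le)
  have := h.pos
  by_contra! hη
  nlinarith [mul_neg_of_neg_of_pos hη (pow_pos this 2)]

theorem abs_lt (h : IsNearParabola L T s J η δ) (ht : t ∈ T) (hL : 0 ≤ L t) : |t| < δ :=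
  not_le.1 fun hδ => (h.neg t ht hδ).not_ge hL

theorem mem_of_abs_le (h : IsNearParabola L T s J η δ) (ht : |t| ≤ δ) : t ∈ T :=
  h.Icc_subset (abs_le.1 ht)

theorem two_mul_abs_lt (h : IsNearParabola L T s J η δ) : 2 * |s| < (J + η) * δ := by
  have hδ := h.pos
  have hdelta : |δ| = δ := abs_of_pos hδ
  have hright := (h.sub_le hdelta.le).trans_lt (h.neg δ (h.mem_of_abs_le hdelta.le) hdelta.ge)
  rw [← abs_neg] at hdelta
  have hleft := (h.sub_le hdelta.le).trans_lt (h.neg (-δ) (h.mem_of_abs_le hdelta.le) hdelta.ge)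
  rcases abs_cases s with hs | hs <;> rw [hs.1] <;> nlinarith

theorem abs_sq_argmax_sub_le (h : IsNearParabola L T s J η δ) (hJ : 0 < J) (hρ : 0 ≤ ρ)
    (hρ1 : ρ ≤ 1) (hη : 8 * η ≤ ρ ^ 2 * J) (ht : t ∈ T) (hmax : IsMaxOn L T t) :
    |t ^ 2 - (s / J) ^ 2| ≤ 3 * ρ * (s / J) ^ 2 := by
  have hη0 := h.error_nonneg
  have hδ := h.pos
  have hηJ : 8 * η ≤ J := hη.trans (mul_le_of_le_one_left hJ.le (pow_le_one₀ hρ hρ1))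
  have hL0 : 0 ≤ L 0 := by simpa using h.sub_le (t := 0) (by simpa using hδ.le)
  have htδ : |t| < δ :=
    h.abs_lt ht (hL0.trans (hmax (h.mem_of_abs_le (by simpa using hδ.le))))
  set r := s / J with hr
  have hsr : s = J * r := by rw [hr, mul_div_cancel₀ _ hJ.ne']
  have hrδ : |r| < δ := by
    rw [hr, abs_div, abs_of_pos hJ, div_lt_iff₀ hJ]
    nlinarith [h.two_mul_abs_lt]
  have hquad : J * (t - r) ^ 2 ≤ η * (t ^ 2 + r ^ 2) := by
    have hle : L r ≤ L t := hmax (h.mem_of_abs_le hrδ.le)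
    have hlow := h.sub_le hrδ.le
    have hup := h.le_sub htδ.le
    rw [hsr] at hlow hup
    linarith
  have hsq : (t - r) ^ 2 ≤ (ρ * r) ^ 2 := by
    refine le_of_mul_le_mul_left ?_ hJ
    nlinarith [mul_nonneg hη0 (sq_nonneg (t - 2 * r)), mul_le_mul_of_nonneg_right hη (sq_nonneg r),
      mul_le_mul_of_nonneg_right hηJ (sq_nonneg (t - r))]
  refine abs_sq_sub_sq_le hρ1 ?_
  rw [← abs_of_nonneg hρ, ← abs_mul]
  exact sq_le_sq.1 hsq

theorem uIcc_subset_superlevel (h : IsNearParabola L T s J η δ) (hJ : 0 < J) :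
    uIcc 0 (s / (J + η)) ⊆ {x | 2 * x ∈ T ∧ 0 ≤ L (2 * x)} := by
  intro x hx
  have hpos : 0 < J + η := by linarith [h.error_nonneg]
  have hxδ : |2 * x| ≤ δ := by
    have hxs : |x| ≤ |s| / (J + η) := by
      simpa only [sub_zero, abs_div, abs_of_pos hpos] using abs_sub_left_of_mem_uIcc hx
    rw [le_div_iff₀ hpos] at hxs
    rw [abs_mul, abs_two]
    nlinarith [h.two_mul_abs_lt]
  exact ⟨h.mem_of_abs_le hxδ, by
    linarith [h.sub_le hxδ, (mem_uIcc_zero_div_iff hpos).1 hx]⟩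

theorem superlevel_subset_uIcc (h : IsNearParabola L T s J η δ) (hη : η < J) :
    {x | 2 * x ∈ T ∧ 0 ≤ L (2 * x)} ⊆ uIcc 0 (s / (J - η)) := by
  rintro x ⟨hxT, hLx⟩
  rw [mem_uIcc_zero_div_iff (sub_pos.2 hη)]
  linarith [h.le_sub (h.abs_lt hxT hLx).le]

theorem abs_two_mul_setIntegral_superlevel_sub_le (h : IsNearParabola L T s J η δ) (hJ : 0 < J)
    (hρ : 0 ≤ ρ) (hρ1 : ρ ≤ 1) (hη : 8 * η ≤ ρ ^ 2 * J) :
    |2 * (∫ x in {x | 2 * x ∈ T ∧ 0 ≤ L (2 * x)}, |x|) - (s / J) ^ 2| ≤ 3 * ρ * (s / J) ^ 2 := by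
  have hη0 := h.error_nonneg
  have hηρ : 8 * η ≤ ρ * J := hη.trans (by nlinarith [mul_nonneg hρ hJ.le])
  have hηJ : η < J := by nlinarith
  have hint (r : ℝ) : IntegrableOn (fun x : ℝ => |x|) (uIcc 0 r) :=
    continuous_abs.continuousOn.integrableOn_uIcc
  have hlow : (s / (J + η)) ^ 2 ≤ 2 * ∫ x in {x | 2 * x ∈ T ∧ 0 ≤ L (2 * x)}, |x| := by
    have := setIntegral_mono_set ((hint _).mono_set (h.superlevel_subset_uIcc hηJ))
      (ae_of_all _ fun x => abs_nonneg x) (h.uIcc_subset_superlevel hJ).eventuallyLE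
    rw [setIntegral_uIcc_zero_abs] at this
    linarith
  have hup : 2 * ∫ x in {x | 2 * x ∈ T ∧ 0 ≤ L (2 * x)}, |x| ≤ (s / (J - η)) ^ 2 := by
    have := setIntegral_mono_set (hint _) (ae_of_all _ fun x => abs_nonneg x)
      (h.superlevel_subset_uIcc hηJ).eventuallyLE
    rw [setIntegral_uIcc_zero_abs] at this
    linarith
  have hcloseLow := abs_le.1 (abs_sq_div_add_sub_sq_div_le (s := s) (e := η) hJ hρ1
    (by rwa [abs_of_nonneg hη0]))
  have hcloseUp := abs_le.1 (abs_sq_div_add_sub_sq_div_le (s := s) (e := -η) hJ hρ1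
    (by rwa [abs_neg, abs_of_nonneg hη0]))
  rw [← sub_eq_add_neg] at hcloseUp
  exact abs_le.2 ⟨hcloseLow.1.trans (sub_le_sub_right hlow _),
    (sub_le_sub_right hup _).trans hcloseUp.2⟩

end IsNearParabola

section Taylor

variable {u v θ₀ θ θ' B : ℝ} {φ : ℝ → ℝ}

theorem hasDerivWithinAt_iteratedDerivWithin (huv : u < v) (hφ : ContDiffOn ℝ 3 φ (Icc u v))
    {i : ℕ} (hi : i < 3) (hθ : θ ∈ Icc u v) :
    HasDerivWithinAt (iteratedDerivWithin i φ (Icc u v))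
      (iteratedDerivWithin (i + 1) φ (Icc u v) θ) (Icc u v) θ := by
  rw [iteratedDerivWithin_succ]
  exact (hφ.differentiableOn_iteratedDerivWithin (by exact_mod_cast hi) (uniqueDiffOn_Icc huv) θ
    hθ).hasDerivWithinAt

theorem iteratedDerivWithin_subset {k n : ℕ} {s t : Set ℝ} (hst : s ⊆ t) (hs : UniqueDiffOn ℝ s)
    (ht : UniqueDiffOn ℝ t) (hφ : ContDiffOn ℝ n φ t) (hk : k ≤ n) (hθ : θ ∈ s) :
    iteratedDerivWithin k φ s θ = iteratedDerivWithin k φ t θ := by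
  rw [iteratedDerivWithin, iteratedDerivWithin,
    iteratedFDerivWithin_subset hst hs ht (hφ.of_le (by exact_mod_cast hk)) hθ]

theorem abs_sub_quadratic_le (huv : u < v) (hφ : ContDiffOn ℝ 3 φ (Icc u v))
    (hB : ∀ θ ∈ Icc u v, |iteratedDerivWithin 3 φ (Icc u v) θ| ≤ B)
    (hθ₀ : θ₀ ∈ Icc u v) (hθ : θ ∈ Icc u v) :
    |φ θ - φ θ₀ - (iteratedDerivWithin 1 φ (Icc u v) θ₀ * (θ - θ₀) +
      iteratedDerivWithin 2 φ (Icc u v) θ₀ * (θ - θ₀) ^ 2 / 2)| ≤ B * |θ - θ₀| ^ 3 / 6 := by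
  rcases eq_or_ne θ₀ θ with rfl | hne
  · simp
  have hsub : uIcc θ₀ θ ⊆ Icc u v := uIcc_subset_Icc hθ₀ hθ
  have hderiv {k : ℕ} (hk : k ≤ 3) {y : ℝ} (hy : y ∈ uIcc θ₀ θ) :
      iteratedDerivWithin k φ (uIcc θ₀ θ) y = iteratedDerivWithin k φ (Icc u v) y :=
    iteratedDerivWithin_subset hsub (uniqueDiffOn_uIcc hne) (uniqueDiffOn_Icc huv) hφ hk hy
  have hφ' : ContDiffOn ℝ 3 φ (uIcc θ₀ θ) := hφ.mono hsub
  obtain ⟨y, hy, hrem⟩ := taylor_mean_remainder_lagrange (n := 2) hne (hφ'.of_le (by norm_num))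
    ((hφ'.differentiableOn_iteratedDerivWithin (by norm_num) (uniqueDiffOn_uIcc hne)).mono
      uIoo_subset_uIcc_self)
  have hy' := uIoo_subset_uIcc_self hy
  have hexpand : φ θ - φ θ₀ - (iteratedDerivWithin 1 φ (Icc u v) θ₀ * (θ - θ₀) +
      iteratedDerivWithin 2 φ (Icc u v) θ₀ * (θ - θ₀) ^ 2 / 2) =
      iteratedDerivWithin 3 φ (Icc u v) y * (θ - θ₀) ^ 3 / 6 := by
    rw [← hderiv le_rfl hy', ← hderiv (k := 1) (by norm_num) left_mem_uIcc,
      ← hderiv (k := 2) (by norm_num) left_mem_uIcc,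
      show (6 : ℝ) = (2 + 1).factorial by norm_num, ← hrem,
      taylorWithinEval_succ, taylorWithinEval_succ, taylor_within_zero_eval]
    norm_num
    ring
  rw [hexpand, abs_div, abs_mul, abs_pow, abs_of_pos (by norm_num : (0 : ℝ) < 6)]
  gcongr
  exact hB y (hsub hy')

end Taylor

/-- The log-likelihood ratio of one observation between the parameter values `θ` and `θ₀`. -/
noncomputable def logRatio {S : Type*} (f : ℝ → S → ℝ) (θ₀ θ : ℝ) (x : S) : ℝ :=
  Real.log (f θ x) - Real.log (f θ₀ x)

/-- The smoothness and domination conditions on the log-density at the observation `x`, for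
parameters in `[u, v]`. -/
structure IsRegularAt {S : Type*} (f : ℝ → S → ℝ) (u v : ℝ) (b : Fin 4 → S → ℝ) (x : S) :
    Prop where
  pos : ∀ θ ∈ Icc u v, 0 < f θ x
  contDiffOn : ContDiffOn ℝ 3 (fun θ => Real.log (f θ x)) (Icc u v)
  bound : ∀ θ ∈ Icc u v, ∀ i : Fin 4, |logDensityDeriv f (Icc u v) i θ x| ≤ b i x

namespace IsRegularAt

variable {S : Type*} {f : ℝ → S → ℝ} {u v θ₀ θ : ℝ} {b : Fin 4 → S → ℝ} {x : S}

theorem hasDerivAt_logDensityDeriv (h : IsRegularAt f u v b x) {i : ℕ} (hi : i < 3)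
    (hθ : θ ∈ Ioo u v) :
    HasDerivAt (fun t => logDensityDeriv f (Icc u v) i t x)
      (logDensityDeriv f (Icc u v) (i + 1) θ x) θ :=
  (hasDerivWithinAt_iteratedDerivWithin (hθ.1.trans hθ.2) h.contDiffOn hi
    (Ioo_subset_Icc_self hθ)).hasDerivAt (Icc_mem_nhds hθ.1 hθ.2)

theorem abs_log_le (h : IsRegularAt f u v b x) (hθ : θ ∈ Icc u v) :
    |Real.log (f θ x)| ≤ b 0 x := by
  simpa only [logDensityDeriv, Fin.coe_ofNat_eq_mod, Nat.zero_mod, iteratedDerivWithin_zero]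
    using h.bound θ hθ 0

theorem abs_logRatio_le (h : IsRegularAt f u v b x) (huv : u < v) (hθ₀ : θ₀ ∈ Icc u v)
    (hθ : θ ∈ Icc u v) : |logRatio f θ₀ θ x| ≤ b 1 x * |θ - θ₀| := by
  have hderiv (t : ℝ) (ht : t ∈ Icc u v) : HasDerivWithinAt (fun t => Real.log (f t x))
      (logDensityDeriv f (Icc u v) 1 t x) (Icc u v) t := by
    have hlog := hasDerivWithinAt_iteratedDerivWithin huv h.contDiffOn three_pos ht
    rwa [iteratedDerivWithin_zero] at hlog
  exact (convex_Icc u v).norm_image_sub_le_of_norm_hasDerivWithin_le hderiv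
    (fun t ht => h.bound t ht 1) hθ₀ hθ

theorem abs_logRatio_sub_quadratic_le (h : IsRegularAt f u v b x) (huv : u < v)
    (hθ₀ : θ₀ ∈ Icc u v) (hθ : θ ∈ Icc u v) :
    |logRatio f θ₀ θ x - (logDensityDeriv f (Icc u v) 1 θ₀ x * (θ - θ₀) +
      logDensityDeriv f (Icc u v) 2 θ₀ x * (θ - θ₀) ^ 2 / 2)| ≤ b 3 x * |θ - θ₀| ^ 3 / 6 :=
  abs_sub_quadratic_le (φ := fun t => Real.log (f t x)) huv h.contDiffOn
    (fun θ hθ => h.bound θ hθ 3) hθ₀ hθ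

end IsRegularAt

theorem memLp_log_of_ae_isRegularAt {S : Type*} [MeasurableSpace S] {ν : Measure S}
    {f : ℝ → S → ℝ} {u v θ : ℝ} {b : Fin 4 → S → ℝ} (hmeas : Measurable (f θ))
    (hreg : ∀ᵐ x ∂ν, IsRegularAt f u v b x) (hb : MemLp (b 0) 2 ν) (hθ : θ ∈ Icc u v) :
    MemLp (fun x => Real.log (f θ x)) 2 ν := by
  refine hb.mono' hmeas.log.aestronglyMeasurable ?_
  filter_upwards [hreg] with x hx using hx.abs_log_le hθ

theorem nonpos_of_eventually_le_mul {q C : ℝ} (h : ∀ᶠ t : ℝ in 𝓝[>] 0, q ≤ C * t) : q ≤ 0 := by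
  have hlim : Tendsto (fun t : ℝ => C * t) (𝓝[>] 0) (𝓝 (C * 0)) :=
    (continuous_const_mul C).continuousWithinAt
  exact ge_of_tendsto (by rwa [mul_zero] at hlim) h

theorem nonpos_of_eventually_mul_add_le {p q C : ℝ}
    (h : ∀ᶠ t : ℝ in 𝓝[>] 0, p * t + q * t ^ 2 / 2 ≤ C * t ^ 3) : p ≤ 0 := by
  refine nonpos_of_eventually_le_mul (C := |C| + |q|) ?_
  filter_upwards [h, self_mem_nhdsWithin, nhdsWithin_le_nhds (Iio_mem_nhds one_pos)]
    with t ht (ht0 : 0 < t) (ht1 : t < 1)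
  refine le_of_mul_le_mul_right ?_ ht0
  have hC : C * t ^ 3 ≤ |C| * t ^ 2 :=
    mul_le_mul (le_abs_self C) (pow_le_pow_of_le_one ht0.le ht1.le (by norm_num)) (by positivity)
      (abs_nonneg C)
  nlinarith [mul_le_mul_of_nonneg_right (neg_abs_le q) (sq_nonneg t), abs_nonneg q]

theorem eq_zero_and_nonpos_of_eventually_quadratic_le {p q C : ℝ}
    (h : ∀ᶠ t : ℝ in 𝓝 0, p * t + q * t ^ 2 / 2 ≤ C * |t| ^ 3) : p = 0 ∧ q ≤ 0 := by
  have hright : ∀ᶠ t : ℝ in 𝓝[>] 0, p * t + q * t ^ 2 / 2 ≤ C * t ^ 3 := by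
    filter_upwards [nhdsWithin_le_nhds h, self_mem_nhdsWithin] with t ht (ht0 : 0 < t)
    rwa [abs_of_pos ht0] at ht
  have hleft : ∀ᶠ t : ℝ in 𝓝[>] 0, -p * t + q * t ^ 2 / 2 ≤ C * t ^ 3 := by
    have hneg : Tendsto (fun t : ℝ => -t) (𝓝 0) (𝓝 0) := by
      simpa using (continuous_neg (G := ℝ)).tendsto 0
    filter_upwards [nhdsWithin_le_nhds (hneg.eventually h), self_mem_nhdsWithin]
      with t ht (ht0 : 0 < t)
    rw [abs_neg, abs_of_pos ht0] at ht
    linarith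
  have hp : p = 0 := le_antisymm (nonpos_of_eventually_mul_add_le hright)
    (neg_nonpos.1 (nonpos_of_eventually_mul_add_le hleft))
  refine ⟨hp, nonpos_of_eventually_le_mul (C := 2 * C) ?_⟩
  filter_upwards [hright, self_mem_nhdsWithin] with t ht (ht0 : 0 < t)
  refine le_of_mul_le_mul_right (a := t ^ 2) ?_ (by positivity)
  rw [hp] at ht
  linarith

/-- A family of functions on the interval `[u, v]` that is regular almost everywhere, with
square-integrable dominating functions, and whose expected logarithm has a unique maximum at the
interior point `θ₀`, with non-vanishing expected second derivative: the assumptions A0 to A4, in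
terms of the law `ν` of one observation. -/
structure IsRegularModel {S : Type*} [MeasurableSpace S] (ν : Measure S) (f : ℝ → S → ℝ)
    (u v θ₀ : ℝ) (b : Fin 4 → S → ℝ) : Prop where
  measurable : ∀ θ ∈ Icc u v, Measurable (f θ)
  mem : θ₀ ∈ Ioo u v
  regular : ∀ᵐ x ∂ν, IsRegularAt f u v b x
  memLp_bound : ∀ i, MemLp (b i) 2 ν
  integral_log_lt : ∀ θ ∈ Icc u v, θ ≠ θ₀ →
    ∫ x, Real.log (f θ x) ∂ν < ∫ x, Real.log (f θ₀ x) ∂ν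
  curvature_ne_zero : ∫ x, logDensityDeriv f (Icc u v) 2 θ₀ x ∂ν ≠ 0

namespace IsRegularModel

variable {S : Type*} [MeasurableSpace S] {ν : Measure S} {f : ℝ → S → ℝ} {u v θ₀ θ : ℝ}
  {b : Fin 4 → S → ℝ}

theorem lt (h : IsRegularModel ν f u v θ₀ b) : u < v := h.mem.1.trans h.mem.2

theorem mem_Icc (h : IsRegularModel ν f u v θ₀ b) : θ₀ ∈ Icc u v := Ioo_subset_Icc_self h.mem

theorem memLp_log (h : IsRegularModel ν f u v θ₀ b) (hθ : θ ∈ Icc u v) :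
    MemLp (fun x => Real.log (f θ x)) 2 ν :=
  memLp_log_of_ae_isRegularAt (h.measurable θ hθ) h.regular (h.memLp_bound 0) hθ

theorem memLp_logRatio (h : IsRegularModel ν f u v θ₀ b) (hθ : θ ∈ Icc u v) :
    MemLp (logRatio f θ₀ θ) 2 ν :=
  (h.memLp_log hθ).sub (h.memLp_log h.mem_Icc)

theorem aemeasurable_logDensityDeriv (h : IsRegularModel ν f u v θ₀ b) {i : ℕ} (hi : i < 4) :
    ∀ θ ∈ Ioo u v, AEMeasurable (logDensityDeriv f (Icc u v) i θ) ν := by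
  induction i with
  | zero =>
    intro θ hθ
    have hzero : logDensityDeriv f (Icc u v) 0 θ = fun x => Real.log (f θ x) :=
      funext fun x => by rw [logDensityDeriv, iteratedDerivWithin_zero]
    exact hzero ▸ (h.measurable θ (Ioo_subset_Icc_self hθ)).log.aemeasurable
  | succ i ih =>
    intro θ hθ
    obtain ⟨t, -, htm, htl⟩ := exists_seq_strictAnti_tendsto' hθ.2
    have htI (n : ℕ) : t n ∈ Ioo u v := ⟨hθ.1.trans (htm n).1, (htm n).2⟩
    have htl' : Tendsto t atTop (𝓝[≠] θ) :=
      tendsto_nhdsWithin_iff.2 ⟨htl, Eventually.of_forall fun n => (htm n).1.ne'⟩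
    refine aemeasurable_of_tendsto_metrizable_ae' (f := fun n x =>
      slope (fun s => logDensityDeriv f (Icc u v) i s x) θ (t n)) (fun n => ?_) ?_
    · simp only [slope_def_field]
      exact ((ih (by omega) _ (htI n)).sub (ih (by omega) _ hθ)).div_const _
    · filter_upwards [h.regular] with x hx
      exact (hasDerivAt_iff_tendsto_slope.1
        (hx.hasDerivAt_logDensityDeriv (by omega) hθ)).comp htl'

theorem memLp_logDensityDeriv (h : IsRegularModel ν f u v θ₀ b) (i : Fin 4) :
    MemLp (logDensityDeriv f (Icc u v) i θ₀) 2 ν := by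
  refine (h.memLp_bound i).mono'
    (h.aemeasurable_logDensityDeriv i.2 θ₀ h.mem).aestronglyMeasurable ?_
  filter_upwards [h.regular] with x hx using hx.bound θ₀ h.mem_Icc i

theorem memLp_score (h : IsRegularModel ν f u v θ₀ b) :
    MemLp (logDensityDeriv f (Icc u v) 1 θ₀) 2 ν := h.memLp_logDensityDeriv 1

theorem memLp_curvature (h : IsRegularModel ν f u v θ₀ b) :
    MemLp (logDensityDeriv f (Icc u v) 2 θ₀) 2 ν := h.memLp_logDensityDeriv 2

theorem integral_bound_nonneg (h : IsRegularModel ν f u v θ₀ b) (i : Fin 4) :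
    0 ≤ ∫ x, b i x ∂ν := by
  refine integral_nonneg_of_ae ?_
  filter_upwards [h.regular] with x hx using (abs_nonneg _).trans (hx.bound θ₀ h.mem_Icc i)

variable [IsFiniteMeasure ν]

theorem integral_logRatio_eq_sub (h : IsRegularModel ν f u v θ₀ b) (hθ : θ ∈ Icc u v) :
    ∫ x, logRatio f θ₀ θ x ∂ν = ∫ x, Real.log (f θ x) ∂ν - ∫ x, Real.log (f θ₀ x) ∂ν :=
  integral_sub ((h.memLp_log hθ).integrable one_le_two)
    ((h.memLp_log h.mem_Icc).integrable one_le_two)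

theorem abs_integral_logRatio_sub_quadratic_le (h : IsRegularModel ν f u v θ₀ b)
    (hθ : θ ∈ Icc u v) :
    |∫ x, logRatio f θ₀ θ x ∂ν -
      ((∫ x, logDensityDeriv f (Icc u v) 1 θ₀ x ∂ν) * (θ - θ₀) +
      (∫ x, logDensityDeriv f (Icc u v) 2 θ₀ x ∂ν) * (θ - θ₀) ^ 2 / 2)| ≤
      (∫ x, b 3 x ∂ν) / 6 * |θ - θ₀| ^ 3 := by
  have hratio := (h.memLp_logRatio hθ).integrable one_le_two
  have hlinear := (h.memLp_score.integrable one_le_two).mul_const (θ - θ₀)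
  have hquadratic := ((h.memLp_curvature.integrable one_le_two).mul_const
    ((θ - θ₀) ^ 2)).div_const 2
  have hsum : Integrable (fun x => logDensityDeriv f (Icc u v) 1 θ₀ x * (θ - θ₀) +
      logDensityDeriv f (Icc u v) 2 θ₀ x * (θ - θ₀) ^ 2 / 2) ν := hlinear.add hquadratic
  have hcubic := (((h.memLp_bound 3).integrable one_le_two).mul_const (|θ - θ₀| ^ 3)).div_const 6
  rw [div_mul_eq_mul_div, ← integral_mul_const, ← integral_mul_const, ← integral_div,
    ← integral_mul_const, ← integral_div, ← integral_add hlinear hquadratic,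
    ← integral_sub hratio hsum]
  refine abs_integral_le_integral_abs.trans
    (integral_mono_ae (hratio.sub hsum).abs hcubic ?_)
  filter_upwards [h.regular] with x hx using hx.abs_logRatio_sub_quadratic_le h.lt h.mem_Icc hθ

theorem eventually_quadratic_le (h : IsRegularModel ν f u v θ₀ b) :
    ∀ᶠ t : ℝ in 𝓝 0, (∫ x, logDensityDeriv f (Icc u v) 1 θ₀ x ∂ν) * t +
      (∫ x, logDensityDeriv f (Icc u v) 2 θ₀ x ∂ν) * t ^ 2 / 2 ≤
        (∫ x, b 3 x ∂ν) / 6 * |t| ^ 3 := by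
  have hshift : Tendsto (fun t : ℝ => θ₀ + t) (𝓝 0) (𝓝 θ₀) := by
    simpa only [add_zero] using (continuous_const_add θ₀).tendsto 0
  filter_upwards [hshift (Icc_mem_nhds h.mem.1 h.mem.2)] with t (ht : θ₀ + t ∈ Icc u v)
  have hexpansion := h.abs_integral_logRatio_sub_quadratic_le ht
  have hmax : ∫ x, logRatio f θ₀ (θ₀ + t) x ∂ν ≤ 0 := by
    rw [h.integral_logRatio_eq_sub ht, sub_nonpos]
    rcases eq_or_ne (θ₀ + t) θ₀ with heq | hne
    · rw [heq]
    · exact (h.integral_log_lt _ ht hne).le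
  rw [add_sub_cancel_left] at hexpansion
  linarith [(abs_le.1 hexpansion).1]

theorem integral_score_eq_zero (h : IsRegularModel ν f u v θ₀ b) :
    ∫ x, logDensityDeriv f (Icc u v) 1 θ₀ x ∂ν = 0 :=
  (eq_zero_and_nonpos_of_eventually_quadratic_le h.eventually_quadratic_le).1

theorem integral_curvature_neg (h : IsRegularModel ν f u v θ₀ b) :
    ∫ x, logDensityDeriv f (Icc u v) 2 θ₀ x ∂ν < 0 :=
  lt_of_le_of_ne (eq_zero_and_nonpos_of_eventually_quadratic_le h.eventually_quadratic_le).2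
    h.curvature_ne_zero

end IsRegularModel

namespace IsRegularModel

variable {S Ω : Type*} [MeasurableSpace S] [MeasurableSpace Ω] {ν : Measure S} {P : Measure Ω}
  {X : ℕ → Ω → S} {f : ℝ → S → ℝ} {u v θ₀ θ₁ : ℝ} {b : Fin 4 → S → ℝ}

theorem rare_not_isRegularAt (h : IsRegularModel ν f u v θ₀ b) (hX : IsIIDSample P X ν) :
    Rare P (fun _ => {ω | ¬ ∀ n, IsRegularAt f u v b (X n ω)}) :=
  .of_ae_notMem ((hX.ae_forall h.regular).mono fun _ => not_not.2)

variable [IsProbabilityMeasure P]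

theorem exists_mem_nhdsWithin_rare (h : IsRegularModel ν f u v θ₀ b) (hX : IsIIDSample P X ν)
    (hθ₁ : θ₁ ∈ Icc u v) (hne : θ₁ ≠ θ₀) :
    ∃ K ∈ 𝓝[Icc u v] θ₁,
      Rare P (fun N => {ω | ∃ θ ∈ K, 0 ≤ empMean X (logRatio f θ₀ θ) N ω}) := by
  have := hX.isProbabilityMeasure
  set M := ∫ x, b 1 x ∂ν
  have hM : 0 ≤ M := h.integral_bound_nonneg 1
  set m := ∫ x, logRatio f θ₀ θ₁ x ∂ν with hm_def
  have hm : m < 0 := by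
    rw [hm_def, h.integral_logRatio_eq_sub hθ₁, sub_neg]
    exact h.integral_log_lt _ hθ₁ hne
  have hr : 0 < -m / (4 * (M + 1)) := div_pos (neg_pos.2 hm) (by positivity)
  refine ⟨Icc u v ∩ Metric.ball θ₁ (-m / (4 * (M + 1))),
    inter_mem_nhdsWithin _ (Metric.ball_mem_nhds _ hr),
    (((hX.rare_le_abs_empMean_sub (h.memLp_logRatio hθ₁) (ε := -m / 2) (by linarith)).union
    (hX.rare_le_abs_empMean_sub (h.memLp_bound 1) one_pos)).union
    (h.rare_not_isRegularAt hX)).mono fun N ω ⟨θ, hθ, hnonneg⟩ => ?_⟩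
  by_contra hω
  simp only [mem_union, mem_ofPred_eq, not_or, not_le, not_not] at hω
  obtain ⟨⟨(hratio : |_ - m| < _), (hbound : |_ - M| < 1)⟩, hreg⟩ := hω
  have hsplit : logRatio f θ₀ θ = logRatio f θ₁ θ + logRatio f θ₀ θ₁ :=
    funext fun x => (sub_add_sub_cancel _ _ _).symm
  have hlipschitz : |empMean X (logRatio f θ₁ θ) N ω| ≤ |θ - θ₁| * empMean X (b 1) N ω := by
    rw [← empMean_smul]
    refine abs_empMean_le fun n => ?_
    rw [Pi.smul_apply, smul_eq_mul, mul_comm]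
    exact (hreg n).abs_logRatio_le h.lt hθ₁ hθ.1
  have hnear : |θ - θ₁| * empMean X (b 1) N ω ≤ -m / 4 := calc
    |θ - θ₁| * empMean X (b 1) N ω ≤ -m / (4 * (M + 1)) * (M + 1) :=
        mul_le_mul_of_nonneg (le_of_lt hθ.2) (by linarith [(abs_lt.1 hbound).2])
          (abs_nonneg _) (by positivity)
    _ = -m / 4 := by field_simp
  rw [hsplit, empMean_add] at hnonneg
  linarith [(abs_le.1 hlipschitz).2, (abs_lt.1 hratio).2]

theorem rare_exists_empMean_logRatio_nonneg (h : IsRegularModel ν f u v θ₀ b)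
    (hX : IsIIDSample P X ν) {K : Set ℝ} (hK : IsCompact K) (hKsub : K ⊆ Icc u v)
    (hθ₀ : θ₀ ∉ K) :
    Rare P (fun N => {ω | ∃ θ ∈ K, 0 ≤ empMean X (logRatio f θ₀ θ) N ω}) := by
  refine hK.induction_on (p := fun K => Rare P (fun N => {ω | ∃ θ ∈ K,
    0 ≤ empMean X (logRatio f θ₀ θ) N ω})) ?empty ?mono ?union ?locally
  case empty => simpa using Rare.of_ae_notMem (P := P) (s := ∅) (by simp)
  case mono => exact fun s t hst ht => ht.mono fun N ω ⟨θ, hθ, hnonneg⟩ => ⟨θ, hst hθ, hnonneg⟩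
  case union =>
    exact fun s t hs ht => (hs.union ht).mono fun N ω ⟨θ, hθ, hnonneg⟩ =>
      hθ.imp (fun hθ => ⟨θ, hθ, hnonneg⟩) fun hθ => ⟨θ, hθ, hnonneg⟩
  case locally =>
    intro θ₁ hθ₁
    obtain ⟨U, hU, hrare⟩ :=
      h.exists_mem_nhdsWithin_rare hX (hKsub hθ₁) (ne_of_mem_of_not_mem hθ₁ hθ₀)
    exact ⟨U, nhdsWithin_mono _ hKsub hU, hrare⟩

theorem exists_rare_near (h : IsRegularModel ν f u v θ₀ b) (hX : IsIIDSample P X ν) {η δ : ℝ}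
    (hη : 0 < η) (hδ : δ * ((∫ x, b 3 x ∂ν) + 1) ≤ η) :
    ∃ B, Rare P B ∧ ∀ N, ∀ ω ∉ B N, ∀ t, θ₀ + t ∈ Icc u v → |t| ≤ δ →
      |empMean X (logRatio f θ₀ (θ₀ + t)) N ω -
        (empMean X (logDensityDeriv f (Icc u v) 1 θ₀) N ω * t -
          (-∫ x, logDensityDeriv f (Icc u v) 2 θ₀ x ∂ν) * t ^ 2 / 2)| ≤ η * t ^ 2 / 2 := by
  refine ⟨_, ((hX.rare_le_abs_empMean_sub h.memLp_curvature (half_pos hη)).union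
    (hX.rare_le_abs_empMean_sub (h.memLp_bound 3) one_pos)).union (h.rare_not_isRegularAt hX),
    fun N ω hω t ht htδ => ?_⟩
  simp only [mem_union, mem_ofPred_eq, not_or, not_le, not_not] at hω
  set M := ∫ x, b 3 x ∂ν
  set q := ∫ x, logDensityDeriv f (Icc u v) 2 θ₀ x ∂ν
  set s := empMean X (logDensityDeriv f (Icc u v) 1 θ₀) N ω
  set H := empMean X (logDensityDeriv f (Icc u v) 2 θ₀) N ω
  obtain ⟨⟨(hcurvature : |H - q| < _), (hbound : |_ - M| < 1)⟩, hreg⟩ := hω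
  have htaylor : |empMean X (logRatio f θ₀ (θ₀ + t)) N ω - (t * s + t ^ 2 / 2 * H)| ≤
      |t| ^ 3 / 6 * empMean X (b 3) N ω := by
    rw [← empMean_smul, ← empMean_smul, ← empMean_smul, ← empMean_add, ← empMean_sub]
    refine abs_empMean_le fun n => ?_
    have := (hreg n).abs_logRatio_sub_quadratic_le h.lt h.mem_Icc ht
    rw [add_sub_cancel_left] at this
    convert this using 1
    · congr 1
      simp only [Pi.sub_apply, Pi.add_apply, Pi.smul_apply, smul_eq_mul]
      ring
    · simp only [Pi.smul_apply, smul_eq_mul]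
      ring
  have hcubic : |t| ^ 3 / 6 * empMean X (b 3) N ω ≤ t ^ 2 / 6 * η := calc
    _ ≤ |t| ^ 3 / 6 * (M + 1) := by gcongr; linarith [(abs_lt.1 hbound).2]
    _ = t ^ 2 / 6 * (|t| * (M + 1)) := by rw [← sq_abs]; ring
    _ ≤ t ^ 2 / 6 * η := by
        have := h.integral_bound_nonneg 3
        gcongr
        exact (mul_le_mul_of_nonneg_right htδ (by positivity)).trans hδ
  have hquadratic : |t ^ 2 / 2 * (H - q)| ≤ t ^ 2 / 2 * (η / 2) := by
    rw [abs_mul, abs_of_nonneg (by positivity : 0 ≤ t ^ 2 / 2)]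
    gcongr
  have := sq_nonneg t
  rw [abs_le] at htaylor hquadratic ⊢
  constructor <;> nlinarith

theorem exists_rare_isNearParabola (h : IsRegularModel ν f u v θ₀ b) (hX : IsIIDSample P X ν)
    {η : ℝ} (hη : 0 < η) :
    ∃ δ B, Rare P B ∧ ∀ N, ∀ ω ∉ B N,
      IsNearParabola (fun t => empMean X (logRatio f θ₀ (θ₀ + t)) N ω)
        (Icc (u - θ₀) (v - θ₀)) (empMean X (logDensityDeriv f (Icc u v) 1 θ₀) N ω)
        (-∫ x, logDensityDeriv f (Icc u v) 2 θ₀ x ∂ν) η δ := by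
  have hM := h.integral_bound_nonneg 3
  set δ := min (min (θ₀ - u) (v - θ₀)) (η / ((∫ x, b 3 x ∂ν) + 1))
  have hδu : δ ≤ θ₀ - u := (min_le_left _ _).trans (min_le_left _ _)
  have hδv : δ ≤ v - θ₀ := (min_le_left _ _).trans (min_le_right _ _)
  have hδ : 0 < δ :=
    lt_min (lt_min (sub_pos.2 h.mem.1) (sub_pos.2 h.mem.2)) (by positivity)
  obtain ⟨B, hB, hnear⟩ := h.exists_rare_near hX hη
    ((le_div_iff₀ (by positivity)).1 (min_le_right _ _ : δ ≤ _))
  have hfar := h.rare_exists_empMean_logRatio_nonneg hX (K := Icc u v \ Ioo (θ₀ - δ) (θ₀ + δ))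
    (isCompact_Icc.diff isOpen_Ioo) sdiff_subset fun hθ₀ => hθ₀.2 (by simpa using hδ)
  refine ⟨δ, _, hB.union hfar, fun N ω hω => ?_⟩
  simp only [mem_union, mem_ofPred_eq, not_or, not_exists, not_and, not_le] at hω
  exact {
    pos := hδ
    Icc_subset := Icc_subset_Icc (by linarith) hδv
    abs_sub_le := fun t ht => hnear N ω hω.1 t
      ⟨by linarith [(abs_le.1 ht).1], by linarith [(abs_le.1 ht).2]⟩ ht
    neg := fun t ht hδt => hω.2 _ ⟨⟨by linarith [ht.1], by linarith [ht.2]⟩, fun hmem =>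
      hδt.not_gt (abs_lt.2 ⟨by linarith [hmem.1], by linarith [hmem.2]⟩)⟩ }

end IsRegularModel

section Fubini

theorem ae_nullMeasurableSet_preimage_prodMk {α β : Type*} [MeasurableSpace α] [MeasurableSpace β]
    {μ : Measure α} {ν : Measure β} [SFinite ν] {E : Set (α × β)}
    (hE : NullMeasurableSet E (μ.prod ν)) : ∀ᵐ a ∂μ, NullMeasurableSet (Prod.mk a ⁻¹' E) ν := by
  obtain ⟨E', -, hE', heq⟩ := hE.exists_measurable_superset_ae_eq
  filter_upwards [Measure.ae_ae_of_ae_prod heq] with a ha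
  exact (measurable_prodMk_left hE').nullMeasurableSet.congr ha

variable {α Ω : Type*} [MeasurableSpace α] [MeasurableSpace Ω] {κ : Measure α}
  {P : Measure Ω} [IsFiniteMeasure P] {E : Set (α × Ω)} {g : α → ℝ}

theorem integrable_indicator_comp_fst (hE : NullMeasurableSet E (κ.prod P))
    (hg : Integrable g κ) :
    Integrable (Function.uncurry fun a ω => E.indicator (fun q => g q.1) (a, ω)) (κ.prod P) :=
  (hg.comp_fst P).indicator₀ hE

theorem ae_integral_indicator_comp_fst_left (hE : NullMeasurableSet E (κ.prod P)) :
    ∀ᵐ a ∂κ, ∫ ω, E.indicator (fun q => g q.1) (a, ω) ∂P = g a * P.real (Prod.mk a ⁻¹' E) := by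
  filter_upwards [ae_nullMeasurableSet_preimage_prodMk hE] with a ha
  rw [mul_comm, ← smul_eq_mul, ← setIntegral_const, ← integral_indicator₀ ha]
  rfl

theorem integrable_mul_measureReal_section (hE : NullMeasurableSet E (κ.prod P))
    (hg : Integrable g κ) : Integrable (fun a => g a * P.real (Prod.mk a ⁻¹' E)) κ :=
  (integrable_indicator_comp_fst hE hg).integral_prod_left.congr
    (ae_integral_indicator_comp_fst_left hE)

variable [SFinite κ]

theorem ae_integral_indicator_comp_fst_right (hE : NullMeasurableSet E (κ.prod P)) :
    ∀ᵐ ω ∂P, ∫ a, E.indicator (fun q => g q.1) (a, ω) ∂κ = ∫ a in {a | (a, ω) ∈ E}, g a ∂κ := by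
  filter_upwards [ae_nullMeasurableSet_preimage_prodMk
    (hE.preimage Measure.measurePreserving_swap.quasiMeasurePreserving)] with ω hω
  exact integral_indicator₀ hω

theorem integrable_setIntegral_section (hE : NullMeasurableSet E (κ.prod P))
    (hg : Integrable g κ) : Integrable (fun ω => ∫ a in {a | (a, ω) ∈ E}, g a ∂κ) P :=
  (integrable_indicator_comp_fst hE hg).integral_prod_right.congr
    (ae_integral_indicator_comp_fst_right hE)

theorem integral_mul_measureReal_section (hE : NullMeasurableSet E (κ.prod P))
    (hg : Integrable g κ) :
    ∫ a, g a * P.real (Prod.mk a ⁻¹' E) ∂κ = ∫ ω, ∫ a in {a | (a, ω) ∈ E}, g a ∂κ ∂P := by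
  rw [← integral_congr_ae (ae_integral_indicator_comp_fst_left hE),
    ← integral_congr_ae (ae_integral_indicator_comp_fst_right hE)]
  exact integral_integral_swap (integrable_indicator_comp_fst hE hg)

end Fubini

theorem aemeasurable_uncurry_of_ae_continuousOn {Ω : Type*} [MeasurableSpace Ω] {P : Measure Ω}
    {κ : Measure ℝ} [SFinite κ] {Φ : ℝ → Ω → ℝ} {a b : ℝ} (hab : a ≤ b)
    (hκ : ∀ᵐ t ∂κ, t ∈ Icc a b) (hcont : ∀ᵐ ω ∂P, ContinuousOn (fun t => Φ t ω) (Icc a b))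
    (hmeas : ∀ t ∈ Icc a b, Measurable (Φ t)) :
    AEMeasurable (Function.uncurry Φ) (κ.prod P) := by
  set T := toMeasurable P {ω | ¬ ContinuousOn (fun t => Φ t ω) (Icc a b)}
  have hT : ∀ᵐ ω ∂P, ω ∉ T := by
    rw [← measure_eq_zero_iff_ae_notMem, measure_toMeasurable]
    exact hcont
  have hcontT (ω : Ω) (hω : ω ∉ T) : ContinuousOn (fun t => Φ t ω) (Icc a b) :=
    not_not.1 fun hdisc => hω (subset_toMeasurable _ _ hdisc)
  refine ⟨Function.uncurry fun t => Tᶜ.indicator (Φ (projIcc a b hab t)),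
    measurable_uncurry_of_continuous_of_measurable (fun ω => ?_) fun t =>
      (hmeas _ (projIcc a b hab t).2).indicator (measurableSet_toMeasurable _ _).compl, ?_⟩
  · by_cases hω : ω ∈ T
    · simpa only [indicator_of_notMem (notMem_compl_iff.2 hω)] using continuous_const
    · simp only [indicator_of_mem (mem_compl hω)]
      exact (hcontT ω hω).comp_continuous (continuous_subtype_val.comp continuous_projIcc)
        fun t => (projIcc a b hab t).2
  · filter_upwards [Measure.quasiMeasurePreserving_fst.ae hκ,
      Measure.quasiMeasurePreserving_snd.ae hT] with ⟨t, ω⟩ ht hω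
    simp only [Function.uncurry_apply_pair, projIcc_of_mem hab ht,
      indicator_of_mem (mem_compl hω)]

section Likelihood

variable {S Ω : Type*} {X : ℕ → Ω → S} {f : ℝ → S → ℝ} {θ₀ θ : ℝ} {N : ℕ} {ω : Ω}

theorem likelihood_eq_exp_sum_log (h : ∀ n, 0 < f θ (X n ω)) :
    likelihood f (sample X N ω) θ =
      Real.exp (∑ i ∈ Finset.range N, Real.log (f θ (X i ω))) := by
  rw [Real.exp_sum, Finset.prod_range]
  exact Finset.prod_congr rfl fun i _ => (Real.exp_log (h i)).symm

theorem likelihood_le_likelihood_iff (h₀ : ∀ n, 0 < f θ₀ (X n ω)) (h : ∀ n, 0 < f θ (X n ω)) :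
    likelihood f (sample X N ω) θ₀ ≤ likelihood f (sample X N ω) θ ↔
      0 ≤ empMean X (logRatio f θ₀ θ) N ω := by
  simp only [empMean_nonneg_iff, likelihood_eq_exp_sum_log h₀, likelihood_eq_exp_sum_log h,
    Real.exp_le_exp, logRatio, Finset.sum_sub_distrib, sub_nonneg]

theorem one_le_likelihood_div_iff (h₀ : ∀ n, 0 < f θ₀ (X n ω)) (h : ∀ n, 0 < f θ (X n ω)) :
    likelihood f (sample X N ω) θ / likelihood f (sample X N ω) θ₀ ≥ 1 ↔
      0 ≤ empMean X (logRatio f θ₀ θ) N ω := by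
  rw [← likelihood_le_likelihood_iff h₀ h, ge_iff_le, one_le_div]
  rw [likelihood_eq_exp_sum_log h₀]
  exact Real.exp_pos _

theorem isMaxOn_empMean_logRatio {Θ : Set ℝ} (h : ∀ θ ∈ Θ, ∀ n, 0 < f θ (X n ω)) (hθ : θ ∈ Θ)
    (hmax : IsMaxOn (likelihood f (sample X N ω)) Θ θ) :
    IsMaxOn (fun t => empMean X (logRatio f θ₀ t) N ω) Θ θ := by
  intro t ht
  have hsub : logRatio f θ₀ θ - logRatio f θ₀ t = logRatio f t θ :=
    funext fun x => sub_sub_sub_cancel_right _ _ _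
  have hle := (likelihood_le_likelihood_iff (h t ht) (h θ hθ)).1 (hmax ht)
  rwa [← hsub, empMean_sub, sub_nonneg] at hle

end Likelihood

theorem measurable_sample {S Ω : Type*} [MeasurableSpace S] [MeasurableSpace Ω] {X : ℕ → Ω → S}
    (hX : ∀ n, Measurable (X n)) (N : ℕ) : Measurable (sample X N) :=
  measurable_pi_iff.2 fun i => hX i

/-- The half-deviations `ε` for which `θ₀ + 2 * ε` is a parameter at least as likely as `θ₀`, with
the likelihood ratio read off from its logarithm. -/
def likelyHalfDeviations {S Ω : Type*} (X : ℕ → Ω → S) (f : ℝ → S → ℝ) (u v θ₀ : ℝ) (N : ℕ)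
    (ω : Ω) : Set ℝ :=
  {ε | 2 * ε ∈ Icc (u - θ₀) (v - θ₀) ∧ 0 ≤ empMean X (logRatio f θ₀ (θ₀ + 2 * ε)) N ω}

theorem setIntegral_restrict_eq_setIntegral_likelyHalfDeviations {S Ω : Type*} (X : ℕ → Ω → S)
    (f : ℝ → S → ℝ) (u v θ₀ : ℝ) (N : ℕ) (ω : Ω) :
    ∫ ε in {ε | 0 ≤ empMean X (logRatio f θ₀ (θ₀ + 2 * ε)) N ω}, |ε|
        ∂(volume.restrict (Icc ((u - θ₀) / 2) ((v - θ₀) / 2))) =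
      ∫ ε in likelyHalfDeviations X f u v θ₀ N ω, |ε| := by
  rw [Measure.restrict_restrict' measurableSet_Icc]
  congr 2
  ext ε
  exact and_comm.trans
    (and_congr_left' (and_congr (div_le_iff₀' zero_lt_two) (le_div_iff₀' zero_lt_two)))

namespace IsRegularModel

variable {S Ω : Type*} [MeasurableSpace S] [MeasurableSpace Ω] {ν : Measure S}
  {f : ℝ → S → ℝ} {u v θ₀ : ℝ} {b : Fin 4 → S → ℝ} {P : Measure Ω} {X : ℕ → Ω → S}
  {est : (N : ℕ) → (Fin N → S) → ℝ}

theorem ae_forall_pos (h : IsRegularModel ν f u v θ₀ b) (hX : IsIIDSample P X ν) :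
    ∀ᵐ ω ∂P, ∀ θ ∈ Icc u v, ∀ n, 0 < f θ (X n ω) := by
  filter_upwards [hX.ae_forall h.regular] with ω hω θ hθ n using (hω n).pos θ hθ

theorem aemeasurable_uncurry_empMean_logRatio (h : IsRegularModel ν f u v θ₀ b)
    (hX : IsIIDSample P X ν) (N : ℕ) :
    AEMeasurable (Function.uncurry fun ε ω => empMean X (logRatio f θ₀ (θ₀ + 2 * ε)) N ω)
      ((volume.restrict (Icc ((u - θ₀) / 2) ((v - θ₀) / 2))).prod P) := by
  have hmaps : MapsTo (fun ε => θ₀ + 2 * ε) (Icc ((u - θ₀) / 2) ((v - θ₀) / 2)) (Icc u v) :=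
    fun ε hε => ⟨by linarith [hε.1], by linarith [hε.2]⟩
  refine aemeasurable_uncurry_of_ae_continuousOn (by linarith [h.lt])
    (ae_restrict_mem measurableSet_Icc) ?_ fun ε hε => ?_
  · filter_upwards [hX.ae_forall h.regular] with ω hω
    exact (continuousOn_finsetSum _ fun i _ => ((hω i).contDiffOn.continuousOn.comp
      (by fun_prop) hmaps).sub continuousOn_const).div_const _
  · exact (Finset.measurable_fun_sum _ fun i _ =>
      (((h.measurable _ (hmaps hε)).log.sub (h.measurable _ h.mem_Icc).log).comp
        (hX.measurable i))).div_const _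

theorem nullMeasurableSet_empMean_logRatio_nonneg (h : IsRegularModel ν f u v θ₀ b)
    (hX : IsIIDSample P X ν) (N : ℕ) :
    NullMeasurableSet {q : ℝ × Ω | 0 ≤ empMean X (logRatio f θ₀ (θ₀ + 2 * q.1)) N q.2}
      ((volume.restrict (Icc ((u - θ₀) / 2) ((v - θ₀) / 2))).prod P) :=
  nullMeasurableSet_le aemeasurable_const (h.aemeasurable_uncurry_empMean_logRatio hX N)

theorem eqOn_predictedMSEIntegrand (h : IsRegularModel ν f u v θ₀ b) (hX : IsIIDSample P X ν)
    (N : ℕ) :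
    EqOn (predictedMSEIntegrand P X f θ₀ N)
      (fun ε => |ε| * P.real {ω | 0 ≤ empMean X (logRatio f θ₀ (θ₀ + 2 * ε)) N ω})
      (Icc ((u - θ₀) / 2) ((v - θ₀) / 2)) := by
  refine fun ε hε => congrArg _ (measureReal_congr ?_)
  filter_upwards [h.ae_forall_pos hX] with ω hω
  exact propext (one_le_likelihood_div_iff (hω _ h.mem_Icc)
    (hω _ ⟨by linarith [hε.1], by linarith [hε.2]⟩))

variable [IsProbabilityMeasure P]

theorem tendsto_mle (h : IsRegularModel ν f u v θ₀ b) (hX : IsIIDSample P X ν)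
    (hest : IsMLE P X f (Icc u v) est) :
    ∀ᵐ ω ∂P, Tendsto (fun N => est N (sample X N ω)) atTop (𝓝 θ₀) := by
  have haway : ∀ᵐ ω ∂P, ∀ k : ℕ, ∀ᶠ N in atTop,
      ω ∉ {ω | ∃ θ ∈ Icc u v \ Metric.ball θ₀ (1 / (k + 1)),
        0 ≤ empMean X (logRatio f θ₀ θ) N ω} :=
    ae_all_iff.2 fun k => (h.rare_exists_empMean_logRatio_nonneg hX
      (isCompact_Icc.diff Metric.isOpen_ball) sdiff_subset fun hθ₀ =>
        hθ₀.2 (Metric.mem_ball_self Nat.one_div_pos_of_nat)).eventually_notMem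
  filter_upwards [haway, h.ae_forall_pos hX, ae_all_iff.2 fun N => (hest N).2]
    with ω hω hpos hmle
  refine Metric.nhds_basis_ball_inv_nat_succ.tendsto_right_iff.2 fun k _ => ?_
  filter_upwards [hω k] with N hN
  by_contra hfar
  exact hN ⟨_, ⟨(hmle N).1, hfar⟩, (likelihood_le_likelihood_iff (hpos _ h.mem_Icc)
    (hpos _ (hmle N).1)).1 ((hmle N).2 h.mem_Icc)⟩

theorem tendsto_mul_integral_of_isNearParabola (h : IsRegularModel ν f u v θ₀ b)
    (hX : IsIIDSample P X ν) {D : ℝ} {W : ℕ → Ω → ℝ} (hW : ∀ N, AEStronglyMeasurable (W N) P)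
    (hWD : ∀ N, ∀ᵐ ω ∂P, |W N ω| ≤ D)
    (happrox : ∀ N, ∀ᵐ ω ∂P, ∀ s J ρ η δ, 0 < J → 0 ≤ ρ → ρ ≤ 1 → 8 * η ≤ ρ ^ 2 * J →
      IsNearParabola (fun t => empMean X (logRatio f θ₀ (θ₀ + t)) N ω)
        (Icc (u - θ₀) (v - θ₀)) s J η δ → |W N ω - (s / J) ^ 2| ≤ 3 * ρ * (s / J) ^ 2) :
    Tendsto (fun N : ℕ => N * ∫ ω, W N ω ∂P) atTop
      (𝓝 ((∫ x, logDensityDeriv f (Icc u v) 1 θ₀ x ^ 2 ∂ν) /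
        (∫ x, logDensityDeriv f (Icc u v) 2 θ₀ x ∂ν) ^ 2)) := by
  have := hX.isProbabilityMeasure
  set g := logDensityDeriv f (Icc u v) 1 θ₀
  set J := -∫ x, logDensityDeriv f (Icc u v) 2 θ₀ x ∂ν with hJ_def
  have hJ : 0 < J := neg_pos.2 h.integral_curvature_neg
  have hg : ∫ x, g x ∂ν = 0 := h.integral_score_eq_zero
  rw [← variance_of_integral_eq_zero h.memLp_score.aestronglyMeasurable.aemeasurable hg,
    ← neg_sq, ← hJ_def, div_eq_inv_mul]
  refine hX.tendsto_mul_integral_of_rare h.memLp_score hW hWD fun ε hε => ?_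
  set ρ := min 1 (ε * J ^ 2 / 3)
  have hρ : 0 < ρ := by positivity
  have hρε : 3 * ρ ≤ ε * J ^ 2 := by linarith [min_le_right 1 (ε * J ^ 2 / 3)]
  obtain ⟨δ, B, hB, hparabola⟩ :=
    h.exists_rare_isNearParabola hX (η := ρ ^ 2 * J / 8) (by positivity)
  refine ⟨B, hB, fun N => ?_⟩
  filter_upwards [happrox N] with ω hω hωB
  have hmain := hω _ J ρ _ δ hJ hρ.le (min_le_left _ _)
    (mul_div_cancel₀ _ (by norm_num)).le (hparabola N ω hωB)
  rw [hg, sub_zero, ← div_eq_inv_mul, ← div_pow]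
  refine hmain.trans ((mul_le_mul_of_nonneg_right hρε (sq_nonneg _)).trans_eq ?_)
  field_simp

theorem tendsto_mul_trueMSE (h : IsRegularModel ν f u v θ₀ b) (hX : IsIIDSample P X ν)
    (hest : IsMLE P X f (Icc u v) est) :
    Tendsto (fun N : ℕ => N * trueMSE P X est θ₀ N) atTop
      (𝓝 ((∫ x, logDensityDeriv f (Icc u v) 1 θ₀ x ^ 2 ∂ν) /
        (∫ x, logDensityDeriv f (Icc u v) 2 θ₀ x ∂ν) ^ 2)) := by
  refine h.tendsto_mul_integral_of_isNearParabola hX (D := (v - u) ^ 2)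
    (fun N => ((((hest N).1.comp (measurable_sample hX.measurable N)).sub_const θ₀).pow_const
      2).aestronglyMeasurable) (fun N => ?_) fun N => ?_
  · filter_upwards [(hest N).2] with ω hω
    rw [abs_of_nonneg (sq_nonneg _)]
    exact sq_le_sq' (by linarith [hω.1.1, h.mem.2]) (by linarith [hω.1.2, h.mem.1])
  · filter_upwards [(hest N).2, h.ae_forall_pos hX] with ω hω hpos s J ρ η δ hJ hρ hρ1 hη hL
    refine hL.abs_sq_argmax_sub_le hJ hρ hρ1 hη
      ⟨sub_le_sub_right hω.1.1 _, sub_le_sub_right hω.1.2 _⟩ fun t ht => ?_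
    have hle := isMaxOn_empMean_logRatio (θ₀ := θ₀) hpos hω.1 hω.2
      (show θ₀ + t ∈ Icc u v from ⟨by linarith [ht.1], by linarith [ht.2]⟩)
    simpa only [mem_ofPred_eq, add_sub_cancel] using hle

theorem intervalIntegrable_predictedMSEIntegrand (h : IsRegularModel ν f u v θ₀ b)
    (hX : IsIIDSample P X ν) (N : ℕ) :
    IntervalIntegrable (predictedMSEIntegrand P X f θ₀ N) volume
      ((u - θ₀) / 2) ((v - θ₀) / 2) := by
  rw [intervalIntegrable_iff_integrableOn_Icc_of_le (by linarith [h.lt]),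
    integrableOn_congr_fun (h.eqOn_predictedMSEIntegrand hX N) measurableSet_Icc]
  exact integrable_mul_measureReal_section (h.nullMeasurableSet_empMean_logRatio_nonneg hX N)
    continuous_abs.integrableOn_Icc

theorem integrable_setIntegral_likelyHalfDeviations (h : IsRegularModel ν f u v θ₀ b)
    (hX : IsIIDSample P X ν) (N : ℕ) :
    Integrable (fun ω => ∫ ε in likelyHalfDeviations X f u v θ₀ N ω, |ε|) P := by
  simp only [← setIntegral_restrict_eq_setIntegral_likelyHalfDeviations]
  exact integrable_setIntegral_section (h.nullMeasurableSet_empMean_logRatio_nonneg hX N)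
    continuous_abs.integrableOn_Icc

theorem predictedMSE_eq_integral (h : IsRegularModel ν f u v θ₀ b) (hX : IsIIDSample P X ν)
    (N : ℕ) :
    predictedMSE P X f u v θ₀ N =
      ∫ ω, 2 * (∫ ε in likelyHalfDeviations X f u v θ₀ N ω, |ε|) ∂P := by
  rw [predictedMSE, integral_const_mul,
    intervalIntegral.integral_of_le (by linarith [h.lt]), ← integral_Icc_eq_integral_Ioc,
    setIntegral_congr_fun measurableSet_Icc (h.eqOn_predictedMSEIntegrand hX N)]
  simp only [← setIntegral_restrict_eq_setIntegral_likelyHalfDeviations]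
  exact congrArg _ (integral_mul_measureReal_section
    (h.nullMeasurableSet_empMean_logRatio_nonneg hX N) continuous_abs.integrableOn_Icc)

theorem tendsto_mul_predictedMSE (h : IsRegularModel ν f u v θ₀ b) (hX : IsIIDSample P X ν) :
    Tendsto (fun N : ℕ => N * predictedMSE P X f u v θ₀ N) atTop
      (𝓝 ((∫ x, logDensityDeriv f (Icc u v) 1 θ₀ x ^ 2 ∂ν) /
        (∫ x, logDensityDeriv f (Icc u v) 2 θ₀ x ∂ν) ^ 2)) := by
  simp only [h.predictedMSE_eq_integral hX]
  refine h.tendsto_mul_integral_of_isNearParabola hX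
    (D := 2 * ∫ ε in Icc ((u - θ₀) / 2) ((v - θ₀) / 2), |ε|)
    (fun N =>
      ((h.integrable_setIntegral_likelyHalfDeviations hX N).const_mul 2).aestronglyMeasurable)
    (fun N => ae_of_all _ fun ω => ?_) fun N => ae_of_all _ fun ω s J ρ η δ hJ hρ hρ1 hη hL =>
      hL.abs_two_mul_setIntegral_superlevel_sub_le hJ hρ hρ1 hη
  have hsub : likelyHalfDeviations X f u v θ₀ N ω ⊆ Icc ((u - θ₀) / 2) ((v - θ₀) / 2) :=
    fun ε hε => ⟨by linarith [hε.1.1], by linarith [hε.1.2]⟩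
  rw [abs_of_nonneg (mul_nonneg zero_le_two (integral_nonneg fun ε => abs_nonneg ε))]
  exact mul_le_mul_of_nonneg_left (setIntegral_mono_set continuous_abs.integrableOn_Icc
    (ae_of_all _ fun ε => abs_nonneg ε) hsub.eventuallyLE) zero_le_two

end IsRegularModel

section Density

variable {S : Type*} [MeasurableSpace S] {μ : Measure S} {f : ℝ → S → ℝ} {θ₀ θ : ℝ}

theorem klDensity_eq_integral_obsLaw (hmeas : Measurable (f θ₀)) (hnonneg : ∀ x, 0 ≤ f θ₀ x) :
    klDensity μ f θ₀ θ = ∫ x, Real.log (f θ₀ x / f θ x) ∂(obsLaw μ f θ₀) := by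
  rw [obsLaw, integral_withDensity_eq_integral_toReal_smul hmeas.ennreal_ofReal
    (ae_of_all _ fun x => ENNReal.ofReal_lt_top)]
  simp only [klDensity, smul_eq_mul, ENNReal.toReal_ofReal (hnonneg _)]

theorem klDensity_eq_sub (hmeas : Measurable (f θ₀)) (hnonneg : ∀ x, 0 ≤ f θ₀ x)
    (hne₀ : ∀ᵐ x ∂(obsLaw μ f θ₀), f θ₀ x ≠ 0) (hne : ∀ᵐ x ∂(obsLaw μ f θ₀), f θ x ≠ 0)
    (hint₀ : Integrable (fun x => Real.log (f θ₀ x)) (obsLaw μ f θ₀))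
    (hint : Integrable (fun x => Real.log (f θ x)) (obsLaw μ f θ₀)) :
    klDensity μ f θ₀ θ = ∫ x, Real.log (f θ₀ x) ∂(obsLaw μ f θ₀) -
      ∫ x, Real.log (f θ x) ∂(obsLaw μ f θ₀) := by
  rw [klDensity_eq_integral_obsLaw hmeas hnonneg, ← integral_sub hint₀ hint]
  refine integral_congr_ae ?_
  filter_upwards [hne₀, hne] with x hx₀ hx using Real.log_div hx₀ hx

theorem IsDensityFamily.isProbabilityMeasure_obsLaw {Θ : Set ℝ} (hf : IsDensityFamily μ f Θ)
    (hθ : θ ∈ Θ) : IsProbabilityMeasure (obsLaw μ f θ) :=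
  ⟨by rw [obsLaw, withDensity_apply _ .univ, setLIntegral_univ, hf.lintegral_eq_one θ hθ]⟩

theorem IsDensityFamily.isRegularModel {u v : ℝ} {b : Fin 4 → S → ℝ}
    (hf : IsDensityFamily μ f (Icc u v)) (hmem : θ₀ ∈ Ioo u v)
    (hreg : ∀ᵐ x ∂(obsLaw μ f θ₀), IsRegularAt f u v b x)
    (hb : ∀ i, MemLp (b i) 2 (obsLaw μ f θ₀))
    (hkl : ∀ θ ∈ Icc u v, θ ≠ θ₀ → klDensity μ f θ₀ θ₀ < klDensity μ f θ₀ θ)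
    (hcurv : ∫ x, logDensityDeriv f (Icc u v) 2 θ₀ x ∂(obsLaw μ f θ₀) ≠ 0) :
    IsRegularModel (obsLaw μ f θ₀) f u v θ₀ b where
  measurable := hf.measurable
  mem := hmem
  regular := hreg
  memLp_bound := hb
  integral_log_lt θ hθ hne := by
    have hθ₀ : θ₀ ∈ Icc u v := Ioo_subset_Icc_self hmem
    have := hf.isProbabilityMeasure_obsLaw hθ₀
    have hlog (t : ℝ) (ht : t ∈ Icc u v) :
        Integrable (fun x => Real.log (f t x)) (obsLaw μ f θ₀) :=
      (memLp_log_of_ae_isRegularAt (hf.measurable t ht) hreg (hb 0) ht).integrable one_le_two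
    have hne0 (t : ℝ) (ht : t ∈ Icc u v) : ∀ᵐ x ∂(obsLaw μ f θ₀), f t x ≠ 0 :=
      hreg.mono fun x hx => (hx.pos t ht).ne'
    have hkl_eq (t : ℝ) (ht : t ∈ Icc u v) := klDensity_eq_sub (hf.measurable _ hθ₀)
      (hf.nonneg _ hθ₀) (hne0 _ hθ₀) (hne0 t ht) (hlog _ hθ₀) (hlog t ht)
    simpa only [hkl_eq θ hθ, hkl_eq θ₀ hθ₀, sub_lt_sub_iff_left] using hkl θ hθ hne
  curvature_ne_zero := hcurv

end Density

theorem proposition1_general {S Ω : Type*} [MeasurableSpace S] [MeasurableSpace Ω]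
    {ν : Measure S} {f : ℝ → S → ℝ} {u v θ₀ : ℝ} {b : Fin 4 → S → ℝ} {P : Measure Ω}
    [IsProbabilityMeasure P] {X : ℕ → Ω → S} {est : (N : ℕ) → (Fin N → S) → ℝ}
    (h : IsRegularModel ν f u v θ₀ b) (hX : IsIIDSample P X ν)
    (hest : IsMLE P X f (Icc u v) est) :
    let I := ∫ x, logDensityDeriv f (Icc u v) 1 θ₀ x ^ 2 ∂ν
    let q := ∫ x, logDensityDeriv f (Icc u v) 2 θ₀ x ∂ν
    (∀ N, IntervalIntegrable (predictedMSEIntegrand P X f θ₀ N) volume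
      ((u - θ₀) / 2) ((v - θ₀) / 2)) ∧
    (∀ᵐ ω ∂P, Tendsto (fun N => est N (sample X N ω)) atTop (𝓝 θ₀)) ∧
    Tendsto (fun N : ℕ => N * trueMSE P X est θ₀ N) atTop (𝓝 (I / q ^ 2)) ∧
    Tendsto (fun N : ℕ => N * predictedMSE P X f u v θ₀ N) atTop (𝓝 (I / q ^ 2)) ∧
    (0 < I → Tendsto (fun N : ℕ => predictedMSE P X f u v θ₀ N / trueMSE P X est θ₀ N)
      atTop (𝓝 1)) := by
  intro I q
  have htrue := h.tendsto_mul_trueMSE hX hest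
  have hpred := h.tendsto_mul_predictedMSE hX
  refine ⟨h.intervalIntegrable_predictedMSEIntegrand hX, h.tendsto_mle hX hest, htrue, hpred,
    fun hI => ?_⟩
  have hV : I / q ^ 2 ≠ 0 := div_ne_zero hI.ne' (pow_ne_zero 2 h.curvature_ne_zero)
  refine (div_self hV ▸ hpred.div htrue hV).congr' ?_
  filter_upwards [eventually_ne_atTop 0] with N hN
  exact mul_div_mul_left _ _ (Nat.cast_ne_zero.2 hN)

theorem proposition1
    {S Ω : Type*} [MeasurableSpace S] [MeasurableSpace Ω]
    (μ : Measure S) (f : ℝ → S → ℝ) (θmin θmax θ₀ : ℝ)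
    (hf : IsDensityFamily μ f (Icc θmin θmax))
    -- the observations are i.i.d. with density `f θ₀`
    (P : Measure Ω) [IsProbabilityMeasure P] (X : ℕ → Ω → S)
    (hXmeas : ∀ n, Measurable (X n))
    (hXindep : iIndepFun X P)
    (hXlaw : ∀ n, P.map (X n) = obsLaw μ f θ₀)
    -- A0: finite support, with the true value in the interior
    (hA0 : θ₀ ∈ Ioo θmin θmax)
    -- A1: `ln f(x; θ)` exists and is three times continuously differentiable in `θ`
    (hA1 : ∀ᵐ x ∂(obsLaw μ f θ₀), (∀ θ ∈ Icc θmin θmax, 0 < f θ x) ∧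
      ContDiffOn ℝ 3 (fun θ => Real.log (f θ x)) (Icc θmin θmax))
    -- A2: domination by functions of finite variance
    (b : Fin 4 → S → ℝ)
    (hb : ∀ i, MemLp (b i) 2 (obsLaw μ f θ₀))
    (hA2 : ∀ᵐ x ∂(obsLaw μ f θ₀), ∀ θ ∈ Icc θmin θmax, ∀ i : Fin 4,
      |logDensityDeriv f (Icc θmin θmax) i θ x| ≤ b i x)
    -- A3: unique minimum of the KL divergence at the true value
    (hA3 : ∀ θ ∈ Icc θmin θmax, θ ≠ θ₀ → klDensity μ f θ₀ θ₀ < klDensity μ f θ₀ θ)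
    -- A4: the expected second derivative does not vanish
    (hA4 : ∫ x, logDensityDeriv f (Icc θmin θmax) 2 θ₀ x ∂(obsLaw μ f θ₀) ≠ 0)
    -- the maximum likelihood estimator
    (est : (N : ℕ) → (Fin N → S) → ℝ)
    (hest : IsMLE P X f (Icc θmin θmax) est) :
    -- the integral in the predicted MSE converges
    (∀ N, IntervalIntegrable (predictedMSEIntegrand P X f θ₀ N) volume
      ((θmin - θ₀) / 2) ((θmax - θ₀) / 2)) ∧
    -- the estimator is strongly consistent
    (∀ᵐ ω ∂P, Tendsto (fun N => est N (sample X N ω)) atTop (𝓝 θ₀)) ∧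
    -- predicted and true MSE agree in the large-sample limit, at the scale `1 / N`
    (∃ V : ℝ,
      Tendsto (fun N : ℕ => (N : ℝ) * trueMSE P X est θ₀ N) atTop (𝓝 V) ∧
      Tendsto (fun N : ℕ => (N : ℝ) * predictedMSE P X f θmin θmax θ₀ N) atTop (𝓝 V)) ∧
    (0 < fisherInformation μ f (Icc θmin θmax) θ₀ →
      Tendsto (fun N : ℕ => predictedMSE P X f θmin θmax θ₀ N / trueMSE P X est θ₀ N)
        atTop (𝓝 1)) ∧
    -- under asymptotic efficiency the predicted MSE is asymptotically the CRLB
    (AsymptoticallyEfficient μ P X f (Icc θmin θmax) est θ₀ →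
      Tendsto (fun N : ℕ => (N : ℝ) * predictedMSE P X f θmin θmax θ₀ N) atTop
        (𝓝 (fisherInformation μ f (Icc θmin θmax) θ₀)⁻¹)) := by
  have hreg : ∀ᵐ x ∂(obsLaw μ f θ₀), IsRegularAt f θmin θmax b x := by
    filter_upwards [hA1, hA2] with x hx hbound using ⟨hx.1, hx.2, hbound⟩
  obtain ⟨hint, hcons, htrue, hpred, hratio⟩ := proposition1_general
    (hf.isRegularModel hA0 hreg hb hA3 hA4) ⟨hXmeas, hXindep, hXlaw⟩ hest
  exact ⟨hint, hcons, ⟨_, htrue, hpred⟩, hratio,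
    fun heff => tendsto_nhds_unique htrue heff.2 ▸ hpred⟩
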